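/- **Conventions.** For a subset $A$ of a poset, $\downarrow A$ is its downward closure, $\mathrm{Max}\,A$ its set of maximal elements, $\mathrm{Lub}(A)$ the set of all existing least upper bounds of (non-empty) directed subsets of $A$, and $cl(A)$ its closure in the Scott topology. Write $A\leq^\flat B$ iff $A\subseteq\,\downarrow B$. A partial map $f$ is *partial monotonic* if its domain is upward-closed and $f$ is monotonic on it; it is *partial continuous* if its domain is Scott-open and $f$ preserves least upper bounds of directed subsets $D$ of $\mathrm{dom} f$ (that exist). An *ordered functional transition system* $\mathfrak S=(S,\stackrel F\to,\leq)$ is a poset $S$ with a finite set $F$ of partial monotonic maps $S\rightharpoonup S$; $s\to s'$ iff $s'=f(s)$ for some $f\in F$. $F^*$ is the set of all finite compositions of maps in $F$ (identity included); $Post$ and $Post^*$ denote immediate successors and reachable states. $Cover_{\mathfrak S}(s)=\,\downarrow Post^*(\downarrow s)$ and $Clover_{\mathfrak S}(s)=\mathrm{Max}\,\mathrm{Lub}(Cover_{\mathfrak S}(s))$. $\mathfrak S$ is *complete* if $S$ is a continuous dcpo that is well-(partially-)ordered and every $f\in F$ is partial continuous. The *lub-acceleration* $g^\infty$ has the same domain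 as $g$, with $g^\infty(x)=\sup_n g^n(x)$ if $x<g(x)$ and $g^\infty(x)=g(x)$ otherwise. $\mathfrak X=(X,\stackrel F\to,\leq)$ is an *$\omega^2$-WSTS* if it is an ordered functional transition system, $\leq$ is a well partial order, and $X$ contains no isomorphic copy of Rado's structure $\{(m,n)\in\mathbb N^2: m<n\}$, where $(m,n)\leq(m',n')$ iff ($m=m'$ and $n\le n'$) or $n<m'$. The *completion* $\widehat{\mathfrak X}$ has as states the ideals (non-empty, directed, downward-closed subsets) of $X$ ordered by inclusion, and as maps the $\mathcal S f$, $f\in F$, with $\mathrm{dom}\,\mathcal Sf=\{C: C\cap\mathrm{dom} f\ne\emptyset\}$ and $\mathcal Sf(C)=\,\downarrow f\langle C\rangle$; let $\eta(x)=\,\downarrow x$. $\widehat{\mathfrak X}$ is *$\infty$-effective* if, for some surjection from a subset of $\mathbb N$ (codes) onto its states, inclusion is decidable on codes and each $\mathcal S f$ ($f\in F$) and each $g^\infty$, $g\in\{\mathcal Sf: f\in F\}^*$, is computable on codes (definedness is decidable, and the value is computable when defined). **Flatness.** $\mathfrak S_1$ is *flat* from $s_1$ if all fireable words of transitions from $s_1$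 lie in some $w_1^*\cdots w_k^*$ with $w_i$ words over its set of maps. A *flattening* of $\mathfrak S$ consists of an ordered functional transition system $\mathfrak S_1$ with initial state $s_1$, flat from $s_1$, and a morphism $\varphi$, i.e. maps $\varphi:S_1\to S$ and $\varphi: F_1\to F$ such that $s'=f_1(s)$ implies $\varphi(s')=\varphi(f_1)(\varphi(s))$ (the right-hand side being defined). It is *monotonic* if $\varphi:S_1\to S$ is, and *continuous* if $\mathfrak S_1$ is complete and $\varphi: S_1\to S$ is Scott-continuous. An *rl-automaton* $\mathcal A$ over $F$ is a finite deterministic automaton with a partial transition function $\delta$, initial state $q_0$ and all states final, whose language is the set of prefixes of words in some $w_1^*\cdots w_k^*$. The product $\mathfrak S\times\mathcal A$ has states $(s,q)$, ordered by $(s,q)\le(s',q')$ iff $s\le s'$ and $q=q'$, and maps $(s,q)\mapsto(f(s),\delta(q,f))$ for those $f\in F$ with $\delta(q,f)$ defined for some $q$; $\pi_1$ is the first projection. * $(\mathfrak X,x_0)$ is *cover-flattable* if some monotonic flattening satisfies $\varphi(x_1)=x_0$ and $Cover_{\mathfrak X}(x_0)=\,\downarrow\varphi\langle Cover_{\mathfrak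 X_1}(x_1)\rangle$; *weakly cover-flattable* if some monotonic flattening satisfies $\varphi(x_1)\le x_0$ and $Cover_{\mathfrak X}(x_0)\subseteq\,\downarrow\varphi\langle Cover_{\mathfrak X_1}(x_1)\rangle$; *strongly cover-flattable* if for some rl-automaton over $F$, $Cover_{\mathfrak X}(x_0)=\pi_1\langle Cover_{\mathfrak X\times\mathcal A}(x_0,q_0)\rangle$. * $(\mathfrak S,s_0)$, $\mathfrak S$ complete, is *clover-flattable* if some continuous flattening satisfies $\varphi(s_1)=s_0$ and $cl(Cover_{\mathfrak S}(s_0))=cl(\varphi\langle cl(Cover_{\mathfrak S_1}(s_1))\rangle)$; *weakly* so if some continuous flattening satisfies $\varphi(s_1)\leq s_0$ and $cl(Cover_{\mathfrak S}(s_0))\subseteq cl(\varphi\langle cl(Cover_{\mathfrak S_1}(s_1))\rangle)$; *strongly* so if for some rl-automaton over its set of maps $cl(Cover_{\mathfrak S}(s_0))=cl(\pi_1\langle cl(Cover_{\mathfrak S\times\mathcal A}(s_0,q_0))\rangle)$. **Procedure Clover$_{\mathfrak S}(s_0)$.** Start with $A=\{s_0\}$; while $Post_{\mathfrak S}(A)\not\leq^\flat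 A$, choose fairly a pair $(g,a)\in F^*\times A$ with $a\in\mathrm{dom}\,g$ and replace $A$ by $A\cup\{g^\infty(a)\}$; return $\mathrm{Max}\,A$. Fairness means that on an infinite execution every pair that can be chosen at some stage is chosen at that stage or a later one. The procedure *terminates* if it has no infinite fair execution. **Theorem.** Let $\mathfrak X=(X,\stackrel F\to,\leq)$ be an $\omega^2$-WSTS whose completion $\widehat{\mathfrak X}$ is $\infty$-effective, and let $x_0\in X$. The following are equivalent: 1. $(\mathfrak X,x_0)$ is cover-flattable; 2. $(\mathfrak X,x_0)$ is weakly cover-flattable; 3. $(\mathfrak X,x_0)$ is strongly cover-flattable; 4. $(\widehat{\mathfrak X},\eta(x_0))$ is clover-flattable; equivalently weakly clover-flattable; equivalently strongly clover-flattable; 5. Clover$_{\widehat{\mathfrak X}}(\eta(x_0))$ terminates. In this case some execution halts, every halting execution returns the clover $A=Clover_{\widehat{\mathfrak X}}(\eta(x_0))$, this set is finite, and $Cover_{\mathfrak X}(x_0)=\eta^{-1}(\downarrow A)$. -/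

import Mathlib

universe u

namespace CoverFlat

/-! ### Order-theoretic notions -/

section Order

variable {S : Type u}

/-- Every (non-empty) directed subset has a least upper bound. -/
def IsDcpo (S : Type u) [PartialOrder S] : Prop :=
  ∀ D : Set S, D.Nonempty → DirectedOn (· ≤ ·) D → ∃ a, IsLUB D a

/-- The way-below relation. -/
def WayBelow [PartialOrder S] (x y : S) : Prop :=
  ∀ D : Set S, D.Nonempty → DirectedOn (· ≤ ·) D → ∀ a, IsLUB D a → y ≤ a → ∃ z ∈ D, x ≤ z

/-- Every element is the directed least upper bound of the elements way below it. -/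
def IsContinuousOrder (S : Type u) [PartialOrder S] : Prop :=
  ∀ x : S, {y | WayBelow y x}.Nonempty ∧ DirectedOn (· ≤ ·) {y | WayBelow y x} ∧
    IsLUB {y | WayBelow y x} x

/-- Continuous directed complete well (partial) order. -/
def IsContinuousDcwo (S : Type u) [PartialOrder S] : Prop :=
  IsDcpo S ∧ IsContinuousOrder S ∧ WellQuasiOrderedLE S

/-- Scott-open sets. -/
def IsScottOpen [PartialOrder S] (U : Set S) : Prop :=
  @IsOpen S (Topology.scott S Set.univ) U

/-- Closure in the Scott topology. -/
def scottClosure [PartialOrder S] (A : Set S) : Set S :=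
  @closure S (Topology.scott S Set.univ) A

/-- Downward closure. -/
def down [PartialOrder S] (A : Set S) : Set S := {x | ∃ y ∈ A, x ≤ y}

/-- The maximal elements of a set. -/
def maxSet [PartialOrder S] (A : Set S) : Set S := {x | Maximal (· ∈ A) x}

/-- All least upper bounds of directed subsets of `A`. -/
def dirLubs [PartialOrder S] (A : Set S) : Set S :=
  {x | ∃ D ⊆ A, D.Nonempty ∧ DirectedOn (· ≤ ·) D ∧ IsLUB D x}

/-- The domination (Hoare) quasi-ordering on sets. -/
def HoareLE [PartialOrder S] (A B : Set S) : Prop := ∀ a ∈ A, ∃ b ∈ B, a ≤ b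

/-- The least upper bound of `A` if it exists (and `d` otherwise). -/
noncomputable def lubOr [PartialOrder S] (d : S) (A : Set S) : S :=
  open Classical in if h : ∃ y, IsLUB A y then h.choose else d

/-- Rado's structure: pairs `m < n`, with `(m, n) ≤ (m', n')` iff `m = m'` and `n ≤ n'`,
or `n < m'`. -/
def radoLE (p q : {p : ℕ × ℕ // p.1 < p.2}) : Prop :=
  (p.1.1 = q.1.1 ∧ p.1.2 ≤ q.1.2) ∨ p.1.2 < q.1.1

/-- A well order (wpo) that contains no isomorphic copy of Rado's structure. -/
def IsOmegaSqWpo (S : Type u) [PartialOrder S] : Prop :=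
  WellQuasiOrderedLE S ∧ IsEmpty (radoLE ↪r ((· ≤ ·) : S → S → Prop))

end Order

/-! ### Partial maps -/

section PartialMaps

variable {S : Type u}

/-- Partial monotonic maps. -/
def PartialMonotone [PartialOrder S] (f : S →. S) : Prop :=
  IsUpperSet f.Dom ∧ ∀ x y x' y', x ≤ y → x' ∈ f x → y' ∈ f y → x' ≤ y'

/-- Partial (Scott-)continuous maps. -/
def PartialContinuous [PartialOrder S] (f : S →. S) : Prop :=
  IsScottOpen f.Dom ∧
    ∀ D : Set S, D ⊆ f.Dom → D.Nonempty → DirectedOn (· ≤ ·) D →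
      ∀ a, IsLUB D a → ∀ b ∈ f a, IsLUB {y | ∃ x ∈ D, y ∈ f x} b

/-- The map defined by a word of partial maps, the first letter being applied first. -/
def wordMap : List (S →. S) → (S →. S)
  | [] => PFun.id S
  | f :: w => (wordMap w).comp f

/-- `n`-fold iteration of a partial map. -/
def iter (f : S →. S) (n : ℕ) : S →. S := wordMap (List.replicate n f)

/-- `F^*`: all compositions of maps in `F`. -/
def compositions (F : Set (S →. S)) : Set (S →. S) :=
  {g | ∃ w : List (S →. S), (∀ f ∈ w, f ∈ F) ∧ g = wordMap w}

/-- The lub-acceleration of a partial map: same domain, and a point `x` of the domain is sent to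
the least upper bound of its iterates if `x < f x`, and to `f x` otherwise. -/
noncomputable def accel [PartialOrder S] (f : S →. S) : S →. S := fun x =>
  open Classical in
  (f x).map fun y => if x < y then lubOr y {z | ∃ n : ℕ, z ∈ iter f n x} else y

end PartialMaps

/-! ### Ordered functional transition systems -/

/-- An ordered functional transition system: a finite set of partial monotonic maps. -/
structure OrdFunTS (S : Type u) [PartialOrder S] where
  F : Set (S →. S)
  finite : F.Finite
  mono : ∀ f ∈ F, PartialMonotone f

namespace OrdFunTS

variable {S : Type u} [PartialOrder S]

/-- One-step transitions. -/
def Step (T : OrdFunTS S) (s s' : S) : Prop := ∃ f ∈ T.F, s' ∈ f s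

/-- Immediate successors of a set of states. -/
def post (T : OrdFunTS S) (A : Set S) : Set S := {s' | ∃ s ∈ A, T.Step s s'}

/-- States reachable from a set of states. -/
def postStar (T : OrdFunTS S) (A : Set S) : Set S :=
  {s' | ∃ s ∈ A, Relation.ReflTransGen T.Step s s'}

/-- The cover of a state. -/
def cover (T : OrdFunTS S) (s : S) : Set S := down (T.postStar (down {s}))

/-- The clover of a state. -/
def clover (T : OrdFunTS S) (s : S) : Set S := maxSet (dirLubs (T.cover s))

/-- Complete transition systems: the state space is a continuous dcwo, and the transition maps are
partial continuous. -/
def IsComplete (T : OrdFunTS S) : Prop :=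
  IsContinuousDcwo S ∧ ∀ f ∈ T.F, PartialContinuous f

end OrdFunTS

/-! ### Effectivity -/

/-- `f` is computable with respect to the representation `r` of the states by codes in `E`: one can
decide whether `f` is defined on the state with a given code, and if so compute a code of the
image. -/
def ComputableVia {S : Type u} {E : Set ℕ} (r : E → S) (f : S →. S) : Prop :=
  ∃ p : ℕ →. Option ℕ, Partrec p ∧
    (∀ e : E, ¬ (f (r e)).Dom → none ∈ p e) ∧
    (∀ e : E, ∀ s ∈ f (r e), ∃ e' : E, some (e' : ℕ) ∈ p e ∧ r e' = s)

/-- The ordering is decidable with respect to the representation `r`. -/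
def DecidableVia {S : Type u} [PartialOrder S] {E : Set ℕ} (r : E → S) : Prop :=
  ∃ d : ℕ × ℕ →. Bool, Partrec d ∧
    ∀ e e' : E, (r e ≤ r e' → true ∈ d (e, e')) ∧ (¬ r e ≤ r e' → false ∈ d (e, e'))

/-- `∞`-effectivity of a (complete) functional transition system: for some representation of the
states, the ordering is decidable, the transition maps are computable, and so are the
lub-accelerations of all their compositions. -/
def InftyEffective {S : Type u} [PartialOrder S] (T : OrdFunTS S) : Prop :=
  ∃ (E : Set ℕ) (r : E → S), Function.Surjective r ∧ DecidableVia r ∧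
    (∀ f ∈ T.F, ComputableVia r f) ∧ (∀ g ∈ compositions T.F, ComputableVia r (accel g))

/-! ### Completion -/

section Completion

variable {X : Type u} [PartialOrder X]

/-- For an ideal `C` meeting the domain of `f`, the ideal `↓ f ⟨C⟩`. -/
def imageIdeal (f : X →. X) (hf : PartialMonotone f) (C : Order.Ideal X)
    (hC : ∃ x ∈ C, x ∈ f.Dom) : Order.Ideal X where
  carrier := {y | ∃ x ∈ C, ∃ z ∈ f x, y ≤ z}
  lower' := fun _ _ hba ⟨x, hx, z, hz, haz⟩ => ⟨x, hx, z, hz, hba.trans haz⟩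
  nonempty' := by
    obtain ⟨x, hx, hd⟩ := hC
    exact ⟨(f x).get hd, x, hx, (f x).get hd, Part.get_mem hd, le_rfl⟩
  directed' := by
    rintro a ⟨x, hx, z, hz, haz⟩ b ⟨y, hy, t, ht, hbt⟩
    obtain ⟨w, hw, hxw, hyw⟩ := C.directed x hx y hy
    have hd : (f w).Dom := hf.1 hxw (Part.dom_iff_mem.2 ⟨z, hz⟩)
    exact ⟨(f w).get hd, ⟨w, hw, _, Part.get_mem hd, le_rfl⟩,
      haz.trans (hf.2 _ _ _ _ hxw hz (Part.get_mem hd)),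
      hbt.trans (hf.2 _ _ _ _ hyw ht (Part.get_mem hd))⟩

/-- The extension of a partial monotonic map to the ideal completion. -/
def idealMap (f : X →. X) (hf : PartialMonotone f) : Order.Ideal X →. Order.Ideal X :=
  fun C => ⟨∃ x ∈ C, x ∈ f.Dom, imageIdeal f hf C⟩

theorem idealMap_partialMonotone (f : X →. X) (hf : PartialMonotone f) :
    PartialMonotone (idealMap f hf) := by
  constructor
  · rintro C D hCD ⟨x, hx, hd⟩
    exact ⟨x, hCD hx, hd⟩
  · rintro C D C' D' hCD ⟨h1, rfl⟩ ⟨h2, rfl⟩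
    rintro y ⟨x, hx, z, hz, hyz⟩
    exact ⟨x, hCD hx, z, hz, hyz⟩

/-- The completion of an ordered functional transition system, on the ideals of the state space. -/
def OrdFunTS.completion (T : OrdFunTS X) : OrdFunTS (Order.Ideal X) where
  F := Set.range fun f : T.F => idealMap f.1 (T.mono f.1 f.2)
  finite := by
    have := T.finite.to_subtype
    exact Set.finite_range _
  mono := by
    rintro _ ⟨f, rfl⟩
    exact idealMap_partialMonotone _ _

/-- The embedding of a poset into its completion. -/
def eta (x : X) : Order.Ideal X := Order.Ideal.principal x

end Completion

/-! ### Flat systems and flattenings -/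

/-- The language `w₁^* w₂^* ⋯ wₖ^*`. -/
def boundedLanguage {A : Type u} (ws : List (List A)) : Language A :=
  (ws.map fun w => KStar.kstar ({w} : Language A)).prod

/-- `T` with initial state `s` is flat: the fireable sequences of transitions from `s` are
contained in some `w₁^* w₂^* ⋯ wₖ^*`. -/
def IsFlat {S : Type u} [PartialOrder S] (T : OrdFunTS S) (s : S) : Prop :=
  ∃ ws : List (List T.F), ∀ w : List T.F,
    (wordMap (w.map Subtype.val) s).Dom → w ∈ boundedLanguage ws

/-- `φ` (with some map on transition functions) is a morphism from `T₁`, flat with initial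
state `s₁`, to `T₂`. -/
def IsFlattening {S₁ S₂ : Type u} [PartialOrder S₁] [PartialOrder S₂]
    (T₁ : OrdFunTS S₁) (T₂ : OrdFunTS S₂) (φ : S₁ → S₂) (s₁ : S₁) : Prop :=
  IsFlat T₁ s₁ ∧
    ∃ ψ : T₁.F → T₂.F, ∀ (f : T₁.F) (s s' : S₁), s' ∈ f.1 s → φ s' ∈ (ψ f).1 (φ s)

/-- Deterministic finite automata with a partial transition function and all states final, that
recognize the prefixes of the words in some `w₁^* w₂^* ⋯ wₖ^*`. -/
structure RLAutomaton (A : Type u) where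
  Q : Type
  finiteQ : Finite Q
  δ : Q → A → Option Q
  q₀ : Q
  isRL : ∃ ws : List (List A), ∀ w : List A,
    (w.foldlM δ q₀).isSome ↔ ∃ v ∈ boundedLanguage ws, w <+: v

/-- States of a synchronized product. -/
@[ext]
structure SyncState (S : Type u) (Q : Type) where
  state : S
  control : Q

instance {S : Type u} {Q : Type} [PartialOrder S] : PartialOrder (SyncState S Q) where
  le p p' := p.state ≤ p'.state ∧ p.control = p'.control
  le_refl _ := ⟨le_rfl, rfl⟩
  le_trans _ _ _ h h' := ⟨h.1.trans h'.1, h.2.trans h'.2⟩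
  le_antisymm _ _ h h' := SyncState.ext (le_antisymm h.1 h'.1) h.2

/-- The partial map `(s, q) ↦ (f s, d q)`. -/
def syncMap {S : Type u} {Q : Type} (f : S →. S) (d : Q → Option Q) :
    SyncState S Q →. SyncState S Q :=
  fun p => (f p.state).bind fun s' => (Part.ofOption (d p.control)).map fun q' => ⟨s', q'⟩

theorem mem_syncMap {S : Type u} {Q : Type} {f : S →. S} {d : Q → Option Q}
    {p p' : SyncState S Q} :
    p' ∈ syncMap f d p ↔ p'.state ∈ f p.state ∧ d p.control = some p'.control := by
  rcases p' with ⟨s', q'⟩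
  simp only [syncMap, Part.mem_bind_iff, Part.mem_map_iff, Part.mem_ofOption, Option.mem_def,
    SyncState.mk.injEq]
  constructor
  · rintro ⟨a, ha, b, hb, rfl, rfl⟩
    exact ⟨ha, hb⟩
  · rintro ⟨ha, hb⟩
    exact ⟨s', ha, q', hb, rfl, rfl⟩

theorem syncMap_partialMonotone {S : Type u} {Q : Type} [PartialOrder S] {f : S →. S}
    (hf : PartialMonotone f) (d : Q → Option Q) : PartialMonotone (syncMap f d) := by
  constructor
  · rintro a b hab ha
    obtain ⟨a', ha'⟩ := Part.dom_iff_mem.1 ha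
    rw [mem_syncMap] at ha'
    obtain ⟨s, hs⟩ := Part.dom_iff_mem.1 (hf.1 hab.1 (Part.dom_iff_mem.2 ⟨_, ha'.1⟩))
    exact Part.dom_iff_mem.2 ⟨⟨s, a'.control⟩, mem_syncMap.2 ⟨hs, hab.2 ▸ ha'.2⟩⟩
  · intro x y x' y' hxy hx hy
    rw [mem_syncMap] at hx hy
    refine ⟨hf.2 _ _ _ _ hxy.1 hx.1 hy.1, ?_⟩
    have h := hx.2
    rw [hxy.2, hy.2] at h
    exact (Option.some.inj h).symm

/-- The synchronized product of a functional transition system with an rl-automaton over its set of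
transition maps. -/
def OrdFunTS.sync {S : Type u} [PartialOrder S] (T : OrdFunTS S) (M : RLAutomaton T.F) :
    OrdFunTS (SyncState S M.Q) where
  F := {h | ∃ f : T.F, (∃ q, (M.δ q f).isSome) ∧ h = syncMap f.1 fun q => M.δ q f}
  finite := by
    have := T.finite.to_subtype
    refine (Set.finite_range fun f : T.F => syncMap f.1 fun q => M.δ q f).subset ?_
    rintro _ ⟨f, _, rfl⟩
    exact ⟨f, rfl⟩
  mono := by
    rintro _ ⟨f, _, rfl⟩
    exact syncMap_partialMonotone (T.mono f.1 f.2) _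

/-! ### Cover- and clover-flattability -/

section Flattable

variable {S : Type u} [PartialOrder S]

def CoverFlattable (T : OrdFunTS S) (x₀ : S) : Prop :=
  ∃ (X₁ : Type u) (_ : PartialOrder X₁) (T₁ : OrdFunTS X₁) (φ : X₁ → S) (x₁ : X₁),
    IsFlattening T₁ T φ x₁ ∧ Monotone φ ∧ φ x₁ = x₀ ∧
      T.cover x₀ = down (φ '' T₁.cover x₁)

def WeaklyCoverFlattable (T : OrdFunTS S) (x₀ : S) : Prop :=
  ∃ (X₁ : Type u) (_ : PartialOrder X₁) (T₁ : OrdFunTS X₁) (φ : X₁ → S) (x₁ : X₁),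
    IsFlattening T₁ T φ x₁ ∧ Monotone φ ∧ φ x₁ ≤ x₀ ∧
      T.cover x₀ ⊆ down (φ '' T₁.cover x₁)

def StronglyCoverFlattable (T : OrdFunTS S) (x₀ : S) : Prop :=
  ∃ M : RLAutomaton T.F,
    T.cover x₀ = SyncState.state '' (T.sync M).cover ⟨x₀, M.q₀⟩

def CloverFlattable (T : OrdFunTS S) (s₀ : S) : Prop :=
  ∃ (S₁ : Type u) (_ : PartialOrder S₁) (T₁ : OrdFunTS S₁) (φ : S₁ → S) (s₁ : S₁),
    T₁.IsComplete ∧ IsFlattening T₁ T φ s₁ ∧ ScottContinuous φ ∧ φ s₁ = s₀ ∧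
      scottClosure (T.cover s₀) = scottClosure (φ '' scottClosure (T₁.cover s₁))

def WeaklyCloverFlattable (T : OrdFunTS S) (s₀ : S) : Prop :=
  ∃ (S₁ : Type u) (_ : PartialOrder S₁) (T₁ : OrdFunTS S₁) (φ : S₁ → S) (s₁ : S₁),
    T₁.IsComplete ∧ IsFlattening T₁ T φ s₁ ∧ ScottContinuous φ ∧ φ s₁ ≤ s₀ ∧
      scottClosure (T.cover s₀) ⊆ scottClosure (φ '' scottClosure (T₁.cover s₁))

def StronglyCloverFlattable (T : OrdFunTS S) (s₀ : S) : Prop :=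
  ∃ M : RLAutomaton T.F,
    scottClosure (T.cover s₀) =
      scottClosure (SyncState.state '' scottClosure ((T.sync M).cover ⟨s₀, M.q₀⟩))

end Flattable

/-! ### The procedure Clover

`A ← {s₀}; while post A is not dominated by A do (choose fairly g in F^* and a in A ∩ dom g;
A ← A ∪ {accel g a}); return Max A`. -/

section Procedure

variable {S : Type u} [PartialOrder S]

/-- One turn of the loop, entered with the set `A`, choosing the pair `c`, and ending with `A'`. -/
def CloverTurn (T : OrdFunTS S) (A : Set S) (c : (S →. S) × S) (A' : Set S) : Prop :=
  ¬ HoareLE (T.post A) A ∧ c.1 ∈ compositions T.F ∧ c.2 ∈ A ∧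
    ∃ b ∈ accel c.1 c.2, A' = A ∪ {b}

/-- Infinite executions; `A n` is the set after `n` turns, `c n` the choice made next. -/
def IsInfiniteExecution (T : OrdFunTS S) (s₀ : S) (A : ℕ → Set S) (c : ℕ → (S →. S) × S) :
    Prop :=
  A 0 = {s₀} ∧ ∀ n, CloverTurn T (A n) (c n) (A (n + 1))

/-- Fairness: every pair that can be chosen at some stage is chosen at some later stage. -/
def IsFair (T : OrdFunTS S) (A : ℕ → Set S) (c : ℕ → (S →. S) × S) : Prop :=
  ∀ m, ∀ g ∈ compositions T.F, ∀ a ∈ A m, a ∈ g.Dom → ∃ n ≥ m, c n = (g, a)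

/-- The procedure terminates: there is no infinite fair execution. -/
def CloverTerminates (T : OrdFunTS S) (s₀ : S) : Prop :=
  ¬ ∃ A c, IsInfiniteExecution T s₀ A c ∧ IsFair T A c

/-- Some execution halts and returns `R`. -/
def CloverReturns (T : OrdFunTS S) (s₀ : S) (R : Set S) : Prop :=
  ∃ (N : ℕ) (A : ℕ → Set S) (c : ℕ → (S →. S) × S),
    A 0 = {s₀} ∧ (∀ n < N, CloverTurn T (A n) (c n) (A (n + 1))) ∧
      HoareLE (T.post (A N)) (A N) ∧ R = maxSet (A N)

end Procedure

end CoverFlat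

open CoverFlat

open CoverFlat

/-!
All seven conditions say that the runs along some bounded language `w₁^* ⋯ wₖ^*` exhaust the cover
up to domination (`OrdFunTS.CoverBounded`) or up to Scott closure (`OrdFunTS.CloverBounded`).

* *Flattenings and automata.* A morphism from a flat system sends its runs to runs along a bounded
  language (`IsFlattening.image_cover_subset`). Conversely, a bounded language is regular, so its
  prefixes are recognized by an rl-automaton (`exists_rlAutomaton`), and the product with an
  rl-automaton is a flattening (`isFlattening_state`), which is complete if the given system is
  (`OrdFunTS.IsComplete.sync`).

* *Completion.* An ideal lies in the Scott closure of a set of ideals iff it is included in their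
  union (`mem_scottClosure_ideal`). Hence the closed cover of `eta x` consists of the ideals
  included in the cover of `x`, and the two boundedness notions agree for `T` and its completion
  (`coverBounded_iff_cloverBounded_completion`). The absence of Rado's structure makes the ideals
  well ordered (`wellQuasiOrderedLE_ideal`, by Ramsey's theorem), so the completion is a complete
  system and the clover, being an antichain, is finite.

* *The procedure.* Each accelerated value lies in the closure of the runs along a bounded
  language, and when an execution halts its finite set dominates the cover; this gives boundedness
  and the returned value (`CloverReturns.spec`). If no execution halted, a dovetailed enumeration
  of the choices would give an infinite fair one (`CloverTerminates.exists_returns`). Conversely,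
  the union of the sets of an infinite fair execution is closed under accelerations. For such a
  set `U`, a word `g` and `e ∈ U`, accelerate `g` repeatedly from `e`. Either a point `p` is
  reached such that `g p` is undefined or `g p ≤ p`, and then `p` dominates all later iterates at
  `e`, or the sequence consists of iterates of `g`; in the latter case the well order
  gives `i < j` with `gⁱ e ≤ gʲ e`, and accelerating `gʲ⁻ⁱ` at `gⁱ e` yields a point whose first
  `j - i` iterates dominate all later iterates at `e` (`exists_finite_dominating_iter`). By
  induction on `w₁, …, wₖ`, finitely many points of `U` dominate the runs along a bounded
  language, so a fair execution halts when such a language exhausts the cover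
  (`OrdFunTS.CloverBounded.terminates`).
-/

namespace CoverFlat

/-! ### Bounded languages -/

section BoundedLanguages

variable {A B : Type u}

theorem mem_boundedLanguage_nil {w : List A} : w ∈ boundedLanguage ([] : List (List A)) ↔ w = [] :=
  Iff.rfl

theorem mem_boundedLanguage_cons {v w : List A} {ws : List (List A)} :
    w ∈ boundedLanguage (v :: ws) ↔
      ∃ n, ∃ x ∈ boundedLanguage ws, w = (List.replicate n v).flatten ++ x := by
  have h : boundedLanguage (v :: ws) = KStar.kstar ({v} : Language A) * boundedLanguage ws := by
    simp [boundedLanguage]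
  rw [h, Language.mem_mul]
  constructor
  · rintro ⟨y, ⟨L, rfl, hL⟩, x, hx, rfl⟩
    refine ⟨L.length, x, hx, ?_⟩
    rw [← List.eq_replicate_of_mem (a := v) fun y hy => hL y hy]
  · rintro ⟨n, x, hx, rfl⟩
    exact ⟨_, ⟨_, rfl, fun y hy => List.eq_of_mem_replicate hy⟩, x, hx, rfl⟩

theorem nil_mem_boundedLanguage (ws : List (List A)) : [] ∈ boundedLanguage ws := by
  induction ws with
  | nil => exact mem_boundedLanguage_nil.2 rfl
  | cons v ws ih => exact mem_boundedLanguage_cons.2 ⟨0, [], ih, rfl⟩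

theorem append_mem_boundedLanguage {ws ws' : List (List A)} {x y : List A}
    (hx : x ∈ boundedLanguage ws) (hy : y ∈ boundedLanguage ws') :
    x ++ y ∈ boundedLanguage (ws ++ ws') := by
  induction ws generalizing x with
  | nil => rw [mem_boundedLanguage_nil.1 hx]; exact hy
  | cons v ws ih =>
    obtain ⟨n, z, hz, rfl⟩ := mem_boundedLanguage_cons.1 hx
    exact mem_boundedLanguage_cons.2 ⟨n, z ++ y, ih hz, List.append_assoc _ _ _⟩

theorem mem_boundedLanguage_append_left {ws : List (List A)} (ws' : List (List A)) {x : List A}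
    (hx : x ∈ boundedLanguage ws) : x ∈ boundedLanguage (ws ++ ws') := by
  simpa using append_mem_boundedLanguage hx (nil_mem_boundedLanguage ws')

theorem mem_boundedLanguage_append_right (ws : List (List A)) {ws' : List (List A)} {x : List A}
    (hx : x ∈ boundedLanguage ws') : x ∈ boundedLanguage (ws ++ ws') := by
  simpa using append_mem_boundedLanguage (nil_mem_boundedLanguage ws) hx

/-- Monoid homomorphisms send bounded languages into bounded languages. -/
theorem mem_boundedLanguage_map {θ : List A → List B} (h0 : θ [] = [])
    (happ : ∀ x y, θ (x ++ y) = θ x ++ θ y) {ws : List (List A)} {x : List A}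
    (hx : x ∈ boundedLanguage ws) : θ x ∈ boundedLanguage (ws.map θ) := by
  induction ws generalizing x with
  | nil => rw [mem_boundedLanguage_nil.1 hx, h0]; exact nil_mem_boundedLanguage _
  | cons v ws ih =>
    obtain ⟨n, z, hz, rfl⟩ := mem_boundedLanguage_cons.1 hx
    refine mem_boundedLanguage_cons.2 ⟨n, θ z, ih hz, ?_⟩
    have : θ (List.replicate n v).flatten = (List.replicate n (θ v)).flatten := by
      induction n with
      | zero => simpa using h0
      | succ n ihn => simp [List.replicate_succ, happ, ihn (by
          exact mem_boundedLanguage_cons.2 ⟨n, z, hz, rfl⟩)]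
    rw [happ, this]

theorem mem_boundedLanguage_of_sublist {x v : List A} (h : x.Sublist v) :
    x ∈ boundedLanguage (v.map fun a => [a]) := by
  induction h with
  | slnil => exact nil_mem_boundedLanguage _
  | cons a _ ih => exact mem_boundedLanguage_cons.2 ⟨0, _, ih, rfl⟩
  | cons_cons a _ ih => exact mem_boundedLanguage_cons.2 ⟨1, _, ih, rfl⟩

/-- The prefixes of a bounded language form a subset of a bounded language: a prefix of `v` lies in
`a₁^* ⋯ aₙ^*`, where `a₁, …, aₙ` are the letters of `v`. -/
theorem mem_boundedLanguage_of_prefix {ws : List (List A)} {x y : List A}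
    (hy : y ∈ boundedLanguage ws) (hxy : x <+: y) :
    x ∈ boundedLanguage (ws.flatMap fun v => v :: v.map fun a => [a]) := by
  induction ws generalizing x y with
  | nil =>
    rw [mem_boundedLanguage_nil.1 hy, List.prefix_nil] at hxy
    rw [hxy]; exact nil_mem_boundedLanguage _
  | cons v ws ih =>
    obtain ⟨n, z, hz, rfl⟩ := mem_boundedLanguage_cons.1 hy
    clear hy
    rw [List.flatMap_cons, List.cons_append]
    induction n generalizing x with
    | zero =>
      exact mem_boundedLanguage_cons.2 ⟨0, x, mem_boundedLanguage_append_right _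
        (ih hz (by simpa using hxy)), rfl⟩
    | succ n ihn =>
      rw [List.replicate_succ, List.flatten_cons, List.append_assoc] at hxy
      rcases List.prefix_or_prefix_of_prefix hxy (List.prefix_append v _) with h | ⟨t, rfl⟩
      · exact mem_boundedLanguage_cons.2 ⟨0, x, mem_boundedLanguage_append_left _
          (mem_boundedLanguage_of_sublist h.sublist), rfl⟩
      · rw [List.prefix_append_right_inj] at hxy
        obtain ⟨m, t', ht', rfl⟩ := mem_boundedLanguage_cons.1 (ihn hxy)
        exact mem_boundedLanguage_cons.2 ⟨m + 1, t', ht', by simp [List.replicate_succ]⟩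

/-- Reading a letter in `v^* L` either starts reading `L` or starts reading `v`. -/
theorem cons_mem_boundedLanguage_cons {v x : List A} {ws : List (List A)} {a : A} :
    a :: x ∈ boundedLanguage (v :: ws) ↔ a :: x ∈ boundedLanguage ws ∨
      ∃ s, v = a :: s ∧ ∃ y ∈ boundedLanguage (v :: ws), x = s ++ y := by
  constructor
  · intro h
    obtain ⟨n, z, hz, h⟩ := mem_boundedLanguage_cons.1 h
    induction n with
    | zero => left; simpa [h] using hz
    | succ n ih =>
      rw [List.replicate_succ, List.flatten_cons, List.append_assoc] at h
      cases v with
      | nil => exact ih (by simpa using h)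
      | cons b s =>
        rw [List.cons_append, List.cons.injEq] at h
        exact Or.inr ⟨s, by rw [h.1], _, mem_boundedLanguage_cons.2 ⟨n, z, hz, rfl⟩, h.2⟩
  · rintro (h | ⟨s, hv, y, hy, rfl⟩)
    · exact mem_boundedLanguage_cons.2 ⟨0, _, h, rfl⟩
    · obtain ⟨n, z, hz, rfl⟩ := mem_boundedLanguage_cons.1 hy
      refine mem_boundedLanguage_cons.2 ⟨n + 1, z, hz, ?_⟩
      rw [List.replicate_succ, List.flatten_cons, List.append_assoc]
      nth_rw 2 [hv]
      rfl

/-- A finite set of languages, one of them the given bounded language, such that every derivative of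
a member by a letter is a union of members. -/
theorem exists_finite_derivatives (ws : List (List A)) :
    ∃ G : Set (Set (List A)), G.Finite ∧ {x | x ∈ boundedLanguage ws} ∈ G ∧
      ∀ g ∈ G, ∀ a, ∃ H ⊆ G, {x | a :: x ∈ g} = ⋃₀ H := by
  induction ws with
  | nil =>
    refine ⟨{{x | x ∈ boundedLanguage ([] : List (List A))}}, Set.finite_singleton _, rfl, ?_⟩
    rintro _ rfl a
    refine ⟨∅, Set.empty_subset _, ?_⟩
    ext x
    simp [mem_boundedLanguage_nil]
  | cons v ws ih =>
    obtain ⟨G, hG, hmem, hder⟩ := ih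
    -- the new members are the languages `s L` with `s` a suffix of `v` and `L` the language `v^* ⋯`
    let R : List A → Set (List A) := fun s => {x | ∃ y ∈ boundedLanguage (v :: ws), x = s ++ y}
    have hnil : {x | x ∈ boundedLanguage (v :: ws)} = R [] := by
      ext x; simp [R]
    refine ⟨G ∪ R '' {s | s <:+ v}, hG.union ((List.finite_toSet v.tails).subset ?_ |>.image _),
      Or.inr ⟨[], List.nil_suffix, hnil.symm⟩, ?_⟩
    · intro s hs
      exact (List.mem_tails _ _).2 hs
    rintro g (hg | ⟨s, hs, rfl⟩) a
    · obtain ⟨H, hH, h⟩ := hder g hg a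
      exact ⟨H, hH.trans Set.subset_union_left, h⟩
    · cases s with
      | nil =>
        obtain ⟨H, hH, h⟩ := hder _ hmem a
        refine ⟨H ∪ {r | ∃ s, v = a :: s ∧ r = R s}, ?_, ?_⟩
        · rintro r (hr | ⟨s, hv, rfl⟩)
          · exact Or.inl (hH hr)
          · exact Or.inr ⟨s, by rw [Set.mem_ofPred_eq, hv]; exact List.suffix_cons a s, rfl⟩
        · rw [Set.sUnion_union, ← h]
          ext x
          rw [← hnil]
          simp only [Set.mem_ofPred_eq, Set.mem_union, Set.mem_sUnion,
            cons_mem_boundedLanguage_cons]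
          refine or_congr_right ⟨?_, ?_⟩
          · rintro ⟨s, hv, hx⟩
            exact ⟨_, ⟨s, hv, rfl⟩, hx⟩
          · rintro ⟨_, ⟨s, hv, rfl⟩, hx⟩
            exact ⟨s, hv, hx⟩
      | cons b s =>
        refine ⟨{r | b = a ∧ r = R s}, ?_, ?_⟩
        · rintro _ ⟨_, rfl⟩
          exact Or.inr ⟨s, (List.suffix_cons b s).trans hs, rfl⟩
        · ext x
          simp only [R, Set.mem_ofPred_eq, Set.mem_sUnion, List.cons_append, List.cons.injEq]
          constructor
          · rintro ⟨y, hy, rfl, rfl⟩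
            exact ⟨_, ⟨rfl, rfl⟩, y, hy, rfl⟩
          · rintro ⟨_, ⟨rfl, rfl⟩, y, hy, rfl⟩
            exact ⟨y, hy, rfl, rfl⟩

theorem isRegular_boundedLanguage (ws : List (List A)) : (boundedLanguage ws).IsRegular := by
  obtain ⟨G, hG, hmem, hder⟩ := exists_finite_derivatives ws
  apply Language.IsRegular.of_finite_range_leftQuotient
  -- a family closed under unions and containing the derivatives of its members by letters
  let U : Set (Set (List A)) := Set.sUnion '' 𝒫 G
  have hU : ∀ r ∈ U, ∀ a, {x | a :: x ∈ r} ∈ U := by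
    rintro _ ⟨H, hH, rfl⟩ a
    choose! K hK hKeq using fun g hg => hder g hg a
    refine ⟨⋃ g ∈ H, K g, Set.iUnion₂_subset fun g hg => hK g (hH hg), ?_⟩
    ext x
    simp only [Set.mem_sUnion, Set.mem_iUnion, exists_prop, Set.mem_ofPred_eq]
    constructor
    · rintro ⟨k, ⟨g, hg, hk⟩, hx⟩
      have : x ∈ {x | a :: x ∈ g} := by rw [hKeq g (hH hg)]; exact ⟨k, hk, hx⟩
      exact ⟨g, hg, this⟩
    · rintro ⟨g, hg, hx⟩
      have : x ∈ {x | a :: x ∈ g} := hx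
      rw [hKeq g (hH hg)] at this
      obtain ⟨k, hk, hx⟩ := this
      exact ⟨k, ⟨g, hg, hk⟩, hx⟩
  have hword : ∀ (y : List A), ∀ r ∈ U, {x | y ++ x ∈ r} ∈ U := by
    intro y
    induction y with
    | nil => exact fun r hr => hr
    | cons a y ih => exact fun r hr => ih _ (hU r hr a)
  refine (hG.powerset.image Set.sUnion).subset ?_
  rintro _ ⟨y, rfl⟩
  exact hword y _ ⟨{_}, Set.singleton_subset_iff.2 hmem, Set.sUnion_singleton _⟩

/-- Every bounded language is recognized, up to prefixes, by an rl-automaton: keep the states of a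
deterministic automaton from which acceptance is still possible. -/
theorem exists_rlAutomaton (ws : List (List A)) :
    ∃ M : RLAutomaton A, ∀ w : List A,
      (w.foldlM M.δ M.q₀).isSome ↔ ∃ v ∈ boundedLanguage ws, w <+: v := by
  classical
  obtain ⟨σ, hσ, D, hD⟩ := (Language.isRegular_iff.{u, 0}).1 (isRegular_boundedLanguage ws)
  let alive : σ → Prop := fun s => ∃ v, D.evalFrom s v ∈ D.accept
  let δ : {s // alive s} → A → Option {s // alive s} := fun s a =>
    if h : alive (D.step s a) then some ⟨_, h⟩ else none
  have key : ∀ (w : List A) (s : {s // alive s}),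
      (w.foldlM δ s).isSome ↔ ∃ v, D.evalFrom s (w ++ v) ∈ D.accept := by
    intro w
    induction w with
    | nil => exact fun s => ⟨fun _ => s.2, fun _ => rfl⟩
    | cons a w ih =>
      intro s
      rw [List.foldlM_cons]
      by_cases h : alive (D.step s a)
      · have : δ s a = some ⟨_, h⟩ := dif_pos h
        rw [this]
        exact ih ⟨_, h⟩
      · have : δ s a = none := dif_neg h
        rw [this]
        exact ⟨fun h => by simp at h, fun ⟨v, hv⟩ => (h ⟨w ++ v, hv⟩).elim⟩
  have h0 : alive D.start := ⟨[], by
    have := nil_mem_boundedLanguage ws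
    rw [← hD] at this
    exact this⟩
  have hacc : ∀ w : List A, (w.foldlM δ ⟨D.start, h0⟩).isSome ↔
      ∃ v ∈ boundedLanguage ws, w <+: v := by
    intro w
    rw [key, ← hD]
    constructor
    · rintro ⟨v, hv⟩
      exact ⟨w ++ v, hv, List.prefix_append _ _⟩
    · rintro ⟨_, hv, v, rfl⟩
      exact ⟨v, hv⟩
  exact ⟨⟨{s // alive s}, inferInstance, δ, ⟨D.start, h0⟩, ws, hacc⟩, hacc⟩

end BoundedLanguages

/-! ### Ramsey's theorem and the well-quasi-ordering of ideals -/

section Ideals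

/-- Infinite Ramsey theorem for colourings of the `k`-element sets of naturals. -/
theorem exists_infinite_homogeneous {κ : Type*} [Finite κ] (k : ℕ) (c : Finset ℕ → κ) {H : Set ℕ}
    (hH : H.Infinite) :
    ∃ H' ⊆ H, H'.Infinite ∧ ∃ d, ∀ s : Finset ℕ, ↑s ⊆ H' → s.card = k → c s = d := by
  induction k generalizing c H with
  | zero =>
    exact ⟨H, subset_rfl, hH, c ∅, fun s _ hs => by rw [Finset.card_eq_zero.1 hs]⟩
  | succ k ih =>
    -- one step: pick a point and pass to a set whose `k`-subsets, joined with it, have one colour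
    have step : ∀ K : {K : Set ℕ // K.Infinite}, ∃ (a : ℕ) (K' : {K : Set ℕ // K.Infinite}) (d : κ),
        a ∈ K.1 ∧ K'.1 ⊆ K.1 ∧ (∀ b ∈ K'.1, a < b) ∧
          ∀ s : Finset ℕ, ↑s ⊆ K'.1 → s.card = k → c (insert a s) = d := by
      rintro ⟨K, hK⟩
      obtain ⟨a, ha⟩ := hK.nonempty
      have hinf : (K \ Set.Iic a).Infinite := hK.sdiff (Set.finite_Iic a)
      obtain ⟨K', hK', hinf', d, hd⟩ := ih (fun s => c (insert a s)) hinf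
      exact ⟨a, ⟨K', hinf'⟩, d, ha, fun b hb => (hK' hb).1,
        fun b hb => not_le.1 (hK' hb).2, hd⟩
    choose pt next col hpt hnext hlt hcol using step
    let K : ℕ → {K : Set ℕ // K.Infinite} := fun n => next^[n] ⟨H, hH⟩
    have hK : ∀ n, K (n + 1) = next (K n) := fun n => Function.iterate_succ_apply' _ _ _
    have hanti : Antitone fun n => (K n).1 :=
      antitone_nat_of_succ_le fun n => by rw [hK]; exact hnext _
    have hmono : StrictMono fun n => pt (K n) :=
      strictMono_nat_of_lt_succ fun n => hlt (K n) _ (by rw [← hK]; exact hpt _)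
    obtain ⟨d, hd⟩ := Finite.exists_infinite_fiber fun n => col (K n)
    rw [Set.infinite_coe_iff] at hd
    refine ⟨_, ?_, hd.image hmono.injective.injOn, d, ?_⟩
    · rintro _ ⟨n, _, rfl⟩
      exact hanti (Nat.zero_le n) (hpt _)
    · intro s hs hcard
      have hne : s.Nonempty := Finset.card_pos.1 (by omega)
      obtain ⟨n, hn, hmin⟩ := hs (s.min'_mem hne)
      replace hmin : pt (K n) = s.min' hne := hmin
      have hmem : pt (K n) ∈ s := by rw [hmin]; exact s.min'_mem hne
      rw [← Finset.insert_erase hmem, ← show col (K n) = d from hn]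
      refine hcol _ _ ?_ (by rw [Finset.card_erase_of_mem hmem]; omega)
      intro b hb
      rw [Finset.mem_coe, Finset.mem_erase] at hb
      obtain ⟨m, _, rfl⟩ := hs hb.2
      have hle : pt (K n) ≤ pt (K m) := hmin ▸ s.min'_le _ hb.2
      have hnm : n < m := hmono.lt_iff_lt.1 (lt_of_le_of_ne hle (Ne.symm hb.1))
      rw [← hK]
      exact hanti hnm (hpt _)

theorem exists_strictMono_homogeneous {κ : Type*} [Finite κ] (f : ℕ → ℕ → ℕ → ℕ → κ) :
    ∃ h : ℕ → ℕ, StrictMono h ∧ ∃ d, ∀ i j k l, i < j → j < k → k < l →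
      f (h i) (h j) (h k) (h l) = d := by
  classical
  obtain ⟨H, -, hH, d, hd⟩ := exists_infinite_homogeneous 4
    (fun s : Finset ℕ => match s.sort (· ≤ ·) with
      | [i, j, k, l] => f i j k l
      | _ => f 0 0 0 0) Set.infinite_univ
  refine ⟨Nat.nth (· ∈ H), Nat.nth_strictMono hH, d, fun i j k l hij hjk hkl => ?_⟩
  have hm := Nat.nth_strictMono hH
  generalize hi' : Nat.nth (· ∈ H) i = i'
  generalize hj' : Nat.nth (· ∈ H) j = j'
  generalize hk' : Nat.nth (· ∈ H) k = k'
  generalize hl' : Nat.nth (· ∈ H) l = l'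
  have h1 : i' < j' := by rw [← hi', ← hj']; exact hm hij
  have h2 : j' < k' := by rw [← hj', ← hk']; exact hm hjk
  have h3 : k' < l' := by rw [← hk', ← hl']; exact hm hkl
  have hnd : [i', j', k', l'].Nodup := by
    simp only [List.nodup_cons, List.mem_cons, List.not_mem_nil, or_false, not_or,
      List.nodup_nil, and_true, not_false_eq_true]
    omega
  have hsort : [i', j', k', l'].toFinset.sort (· ≤ ·) = [i', j', k', l'] := by
    rw [List.toFinset_sort (· ≤ ·) hnd]
    simp only [List.pairwise_cons, List.mem_cons, List.not_mem_nil, or_false, forall_eq_or_imp,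
      forall_eq, List.Pairwise.nil, and_true]
    refine ⟨⟨?_, ?_, ?_⟩, ⟨?_, ?_⟩, ?_, ?_⟩ <;> first | omega | simp
  have := hd [i', j', k', l'].toFinset ?_ (List.toFinset_card_of_nodup hnd)
  · simp only [hsort] at this
    exact this
  · intro b hb
    rw [Finset.mem_coe, List.mem_toFinset] at hb
    simp only [List.mem_cons, List.not_mem_nil, or_false] at hb
    rcases hb with rfl | rfl | rfl | rfl
    · rw [← hi']; exact Nat.nth_mem_of_infinite hH _
    · rw [← hj']; exact Nat.nth_mem_of_infinite hH _
    · rw [← hk']; exact Nat.nth_mem_of_infinite hH _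
    · rw [← hl']; exact Nat.nth_mem_of_infinite hH _

/-- An array `y i j` (`i < j`) with `y i j ≰ y j k` in a well order contains Rado's structure. -/
theorem nonempty_rado_embedding {X : Type u} [PartialOrder X]
    (hX : WellQuasiOrderedLE X) (x : ℕ → ℕ → X)
    (hbad : ∀ i j k, i < j → j < k → ¬ x i j ≤ x j k) :
    Nonempty (radoLE ↪r ((· ≤ ·) : X → X → Prop)) := by
  obtain ⟨h, hh, ⟨d1, d2, d3, d4⟩, hd⟩ := exists_strictMono_homogeneous fun i j k l =>
    (x i j ≤ x i k, x i j ≤ x k l, x i k ≤ x j l, x j k ≤ x i l)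
  let y : ℕ → ℕ → X := fun i j => x (h i) (h j)
  have hy : ∀ i j k, i < j → j < k → ¬ y i j ≤ y j k := fun i j k hij hjk =>
    hbad _ _ _ (hh hij) (hh hjk)
  have hd' : ∀ i j k l, i < j → j < k → k < l →
      ((y i j ≤ y i k) ↔ d1) ∧ ((y i j ≤ y k l) ↔ d2) ∧ ((y i k ≤ y j l) ↔ d3) ∧
        ((y j k ≤ y i l) ↔ d4) := by
    intro i j k l hij hjk hkl
    simpa only [Prod.mk.injEq, eq_iff_iff] using hd i j k l hij hjk hkl
  clear_value y
  have h1 : d1 := by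
    obtain ⟨m, n, hmn, hle⟩ := hX.wqo fun n => y 0 (n + 1)
    exact (hd' 0 (m + 1) (n + 1) (n + 2) (by omega) (by omega) (by omega)).1.1 hle
  have h2 : d2 := by
    obtain ⟨m, n, hmn, hle⟩ := hX.wqo fun n => y (2 * n) (2 * n + 1)
    exact (hd' (2 * m) (2 * m + 1) (2 * n) (2 * n + 1) (by omega) (by omega) (by omega)).2.1.1 hle
  have row : ∀ i j k, i < j → j < k → y i j ≤ y i k := fun i j k hij hjk =>
    (hd' i j k (k + 1) hij hjk (by omega)).1.2 h1
  have sep : ∀ i j k l, i < j → j < k → k < l → y i j ≤ y k l := fun i j k l hij hjk hkl =>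
    (hd' i j k l hij hjk hkl).2.1.2 h2
  have h3 : ¬ d3 := fun h3 => hy 0 2 4 (by omega) (by omega)
    (((hd' 0 1 2 3 (by omega) (by omega) (by omega)).2.2.1.2 h3).trans
      ((hd' 1 2 3 4 (by omega) (by omega) (by omega)).2.2.1.2 h3))
  have h4 : ¬ d4 := fun h4 => hy 0 1 4 (by omega) (by omega)
    ((sep 0 1 2 3 (by omega) (by omega) (by omega)).trans
      ((hd' 1 2 3 4 (by omega) (by omega) (by omega)).2.2.2.2 h4))
  have key : ∀ m n m' n', m < n → m' < n' →
      (y m n ≤ y m' n' ↔ (m = m' ∧ n ≤ n') ∨ n < m') := by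
    intro m n m' n' hmn hmn'
    constructor
    · intro hle
      rcases lt_trichotomy m m' with hlt | rfl | hlt
      · right
        by_contra hcon
        rcases (not_lt.1 hcon).eq_or_lt with rfl | hlt'
        · exact hy _ _ _ hlt hmn' hle
        · exact h3 ((hd' m m' n (n + n' + 1) hlt hlt' (by omega)).2.2.1.1
            (hle.trans (row _ _ _ hmn' (by omega))))
      · left
        refine ⟨rfl, ?_⟩
        by_contra hcon
        exact hy m n (n + 1) hmn (by omega)
          (hle.trans (sep m n' n (n + 1) hmn' (by omega) (by omega)))
      · exact (h4 ((hd' m' m n (n + n' + 1) hlt hmn (by omega)).2.2.2.1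
            (hle.trans (row _ _ _ hmn' (by omega))))).elim
    · rintro (⟨rfl, hle⟩ | hlt)
      · rcases hle.eq_or_lt with rfl | hlt
        · exact le_rfl
        · exact row _ _ _ hmn hlt
      · exact sep _ _ _ _ hmn hlt hmn'
  refine ⟨⟨⟨fun p => y p.1.1 p.1.2, ?_⟩, fun {p q} => key _ _ _ _ p.2 q.2⟩⟩
  rintro ⟨⟨m, n⟩, hmn⟩ ⟨⟨m', n'⟩, hmn'⟩ heq
  have e1 := (key _ _ _ _ hmn hmn').1 heq.le
  have e2 := (key _ _ _ _ hmn' hmn).1 heq.ge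
  simp only at hmn hmn'
  simp only [Subtype.mk.injEq, Prod.mk.injEq]
  omega

/-- The ideals of an `ω²`-wpo are well ordered by inclusion: from a bad sequence of ideals `C i`,
points `x i j ∈ C i \ C j` form an array that contains Rado's structure. -/
theorem wellQuasiOrderedLE_ideal {X : Type u} [PartialOrder X] (hX : IsOmegaSqWpo X) :
    WellQuasiOrderedLE (Order.Ideal X) := by
  refine ⟨fun C => ?_⟩
  by_contra! hcon
  have hex : ∀ i j, ∃ a, i < j → a ∈ C i ∧ a ∉ C j := by
    intro i j
    by_cases hij : i < j
    · obtain ⟨a, ha, ha'⟩ := Set.not_subset.1 (hcon i j hij)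
      exact ⟨a, fun _ => ⟨ha, ha'⟩⟩
    · exact ⟨(C 0).nonempty.some, fun h => (hij h).elim⟩
  choose x hx using hex
  obtain ⟨e⟩ := nonempty_rado_embedding hX.1 x fun i j k hij hjk hle =>
    (hx i j hij).2 ((C j).lower hle (hx j k hjk).1)
  exact hX.2.elim e

end Ideals

/-! ### Scott closed sets -/

section ScottTopology

variable {S S' : Type u} [PartialOrder S] [PartialOrder S']

theorem subset_scottClosure (A : Set S) : A ⊆ scottClosure A :=
  @subset_closure S (Topology.scott S Set.univ) A

theorem scottClosure_mono {A B : Set S} (h : A ⊆ B) : scottClosure A ⊆ scottClosure B :=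
  @closure_mono S (Topology.scott S Set.univ) A B h

theorem scottClosure_minimal {A B : Set S} (h : A ⊆ B) (hl : IsLowerSet B) (hs : DirSupClosed B) :
    scottClosure A ⊆ B :=
  let _ := Topology.scott S Set.univ
  have : Topology.IsScott S Set.univ := ⟨rfl⟩
  closure_minimal h (Topology.IsScott.isClosed_iff_isLowerSet_and_dirSupClosed.2 ⟨hl, hs⟩)

theorem isLowerSet_scottClosure (A : Set S) : IsLowerSet (scottClosure A) :=
  let _ := Topology.scott S Set.univ
  have : Topology.IsScott S Set.univ := ⟨rfl⟩
  Topology.IsScott.isLowerSet_of_isClosed isClosed_closure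

theorem dirSupClosed_scottClosure (A : Set S) : DirSupClosed (scottClosure A) :=
  let _ := Topology.scott S Set.univ
  have : Topology.IsScott S Set.univ := ⟨rfl⟩
  Topology.IsScott.dirSupClosed_of_isClosed isClosed_closure

theorem scottClosure_subset_iff {A B : Set S} : scottClosure A ⊆ scottClosure B ↔
    A ⊆ scottClosure B :=
  ⟨(subset_scottClosure A).trans,
    fun h => scottClosure_minimal h (isLowerSet_scottClosure B) (dirSupClosed_scottClosure B)⟩

theorem isScottOpen_iff {U : Set S} : IsScottOpen U ↔ IsUpperSet U ∧ DirSupInacc U :=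
  let _ := Topology.scott S Set.univ
  have : Topology.IsScott S Set.univ := ⟨rfl⟩
  (Topology.IsScott.isOpen_iff_isUpperSet_and_dirSupInaccOn (D := Set.univ)).trans
    (by rw [dirSupInaccOn_univ])

theorem image_scottClosure_subset {φ : S → S'} (hφ : ScottContinuous φ) (A : Set S) :
    φ '' scottClosure A ⊆ scottClosure (φ '' A) :=
  let _ := Topology.scott S Set.univ
  let _ := Topology.scott S' Set.univ
  have : Topology.IsScott S Set.univ := ⟨rfl⟩
  have : Topology.IsScott S' Set.univ := ⟨rfl⟩
  image_closure_subset_closure_image ((Topology.IsScott.scottContinuousOn_iff_continuous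
    (D := Set.univ) fun _ _ _ => trivial).1 (scottContinuousOn_univ.2 hφ))

theorem subset_down (A : Set S) : A ⊆ down A := fun a ha => ⟨a, ha, le_rfl⟩

theorem isLowerSet_down (A : Set S) : IsLowerSet (down A) :=
  fun _ _ hba ⟨y, hy, hay⟩ => ⟨y, hy, hba.trans hay⟩

theorem down_subset_iff {A B : Set S} (hB : IsLowerSet B) : down A ⊆ B ↔ A ⊆ B :=
  ⟨(subset_down A).trans, fun h _ ⟨_, hy, hxy⟩ => hB hxy (h hy)⟩

theorem down_subset_scottClosure (A : Set S) : down A ⊆ scottClosure A :=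
  (down_subset_iff (isLowerSet_scottClosure A)).2 (subset_scottClosure A)

theorem scottClosure_of_finite {A : Set S} (hA : A.Finite) : scottClosure A = down A := by
  let _ := Topology.scott S Set.univ
  have : Topology.IsScott S Set.univ := ⟨rfl⟩
  change closure A = _
  rw [← Set.biUnion_of_singleton A, hA.closure_biUnion, Set.biUnion_of_singleton]
  ext x
  simp [down]

theorem dirSupClosed_down_of_finite {A : Set S} (hA : A.Finite) : DirSupClosed (down A) := by
  rw [← scottClosure_of_finite hA]
  exact dirSupClosed_scottClosure A

theorem maxSet_down (A : Set S) : maxSet (down A) = maxSet A := by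
  ext x
  constructor
  · rintro ⟨⟨y, hy, hxy⟩, hmax⟩
    obtain rfl : x = y := le_antisymm hxy (hmax (subset_down A hy) hxy)
    exact ⟨hy, fun z hz hxz => hmax (subset_down A hz) hxz⟩
  · rintro ⟨hx, hmax⟩
    refine ⟨subset_down A hx, ?_⟩
    rintro z ⟨y, hy, hzy⟩ hxz
    exact hzy.trans (hmax hy (hxz.trans hzy))

end ScottTopology

/-! ### Words of partial maps -/

section Words

variable {S : Type u}

theorem mem_wordMap_nil {s z : S} : z ∈ wordMap ([] : List (S →. S)) s ↔ z = s :=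
  Part.mem_some_iff

theorem mem_wordMap_cons {f : S →. S} {w : List (S →. S)} {s z : S} :
    z ∈ wordMap (f :: w) s ↔ ∃ t ∈ f s, z ∈ wordMap w t :=
  Part.mem_bind_iff

theorem mem_wordMap_append {v w : List (S →. S)} {s z : S} :
    z ∈ wordMap (v ++ w) s ↔ ∃ t ∈ wordMap v s, z ∈ wordMap w t := by
  induction v generalizing s with
  | nil => simp [mem_wordMap_nil]
  | cons f v ih =>
    simp only [List.cons_append, mem_wordMap_cons, ih]
    constructor
    · rintro ⟨t, ht, r, hr, hz⟩
      exact ⟨r, ⟨t, ht, hr⟩, hz⟩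
    · rintro ⟨r, ⟨t, ht, hr⟩, hz⟩
      exact ⟨t, ht, r, hr, hz⟩

theorem mem_iter_zero {g : S →. S} {s z : S} : z ∈ iter g 0 s ↔ z = s := mem_wordMap_nil

theorem mem_iter_succ {g : S →. S} {n : ℕ} {s z : S} :
    z ∈ iter g (n + 1) s ↔ ∃ t ∈ g s, z ∈ iter g n t := by
  rw [iter, List.replicate_succ, mem_wordMap_cons]; rfl

theorem mem_iter_succ' {g : S →. S} {n : ℕ} {s z : S} :
    z ∈ iter g (n + 1) s ↔ ∃ t ∈ iter g n s, z ∈ g t := by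
  rw [iter, List.replicate_succ', mem_wordMap_append]
  simp [mem_wordMap_cons, mem_wordMap_nil, iter]

theorem iter_wordMap (w : List (S →. S)) (n : ℕ) :
    iter (wordMap w) n = wordMap (List.replicate n w).flatten := by
  induction n with
  | zero => rfl
  | succ n ih =>
    funext s
    ext z
    rw [mem_iter_succ, List.replicate_succ, List.flatten_cons, mem_wordMap_append, ih]

theorem setOf_iter_eq_range {g : S →. S} {a : S} {v : ℕ → S} (hv : ∀ n, v n ∈ iter g n a) :
    {z | ∃ n, z ∈ iter g n a} = Set.range v :=
  Set.ext fun _ => ⟨fun ⟨n, hz⟩ => ⟨n, Part.mem_unique (hv n) hz⟩, fun ⟨n, hz⟩ => ⟨n, hz ▸ hv n⟩⟩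

variable [PartialOrder S]

theorem PartialMonotone.exists_le {f : S →. S} (hf : PartialMonotone f) {x y x' : S} (hxy : x ≤ y)
    (hx' : x' ∈ f x) : ∃ y' ∈ f y, x' ≤ y' := by
  obtain ⟨y', hy'⟩ := Part.dom_iff_mem.1 (hf.1 hxy (Part.dom_iff_mem.2 ⟨x', hx'⟩))
  exact ⟨y', hy', hf.2 _ _ _ _ hxy hx' hy'⟩

theorem partialMonotone_iff {f : S →. S} :
    PartialMonotone f ↔ ∀ x y x', x ≤ y → x' ∈ f x → ∃ y' ∈ f y, x' ≤ y' := by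
  refine ⟨fun hf x y x' => hf.exists_le, fun h => ⟨?_, ?_⟩⟩
  · intro x y hxy hx
    obtain ⟨x', hx'⟩ := Part.dom_iff_mem.1 hx
    obtain ⟨y', hy', -⟩ := h x y x' hxy hx'
    exact Part.dom_iff_mem.2 ⟨y', hy'⟩
  · intro x y x' y' hxy hx' hy'
    obtain ⟨z, hz, hle⟩ := h x y x' hxy hx'
    rwa [Part.mem_unique hy' hz]

theorem partialMonotone_wordMap {w : List (S →. S)} (hw : ∀ f ∈ w, PartialMonotone f) :
    PartialMonotone (wordMap w) := by
  rw [partialMonotone_iff]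
  induction w with
  | nil =>
    intro x y x' hxy hx'
    rw [mem_wordMap_nil] at hx'
    exact ⟨y, mem_wordMap_nil.2 rfl, hx' ▸ hxy⟩
  | cons f w ih =>
    intro x y x' hxy hx'
    obtain ⟨t, ht, hx'⟩ := mem_wordMap_cons.1 hx'
    obtain ⟨t', ht', htt'⟩ := (hw f List.mem_cons_self).exists_le hxy ht
    obtain ⟨y', hy', hle⟩ := ih (fun g hg => hw g (List.mem_cons_of_mem f hg)) _ _ _ htt' hx'
    exact ⟨y', mem_wordMap_cons.2 ⟨t', ht', hy'⟩, hle⟩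

theorem PartialMonotone.iter {g : S →. S} (hg : PartialMonotone g) (n : ℕ) :
    PartialMonotone (iter g n) :=
  partialMonotone_wordMap fun _ hf => List.eq_of_mem_replicate hf ▸ hg

/-- Points all of whose images lie in a Scott closed set form a Scott closed set. -/
theorem PartialContinuous.dirSupClosed_preimage {f : S →. S} (hm : PartialMonotone f)
    (hf : PartialContinuous f) {B : Set S} (hB : DirSupClosed B) :
    DirSupClosed {x | ∀ z ∈ f x, z ∈ B} := by
  intro D hD hne hdir a ha z hz
  obtain ⟨d, hd, hdf⟩ := (isScottOpen_iff.1 hf.1).2 hne hdir ha (Part.dom_iff_mem.2 ⟨z, hz⟩)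
  -- the part of `D` above `d` lies in the domain and has the same least upper bound
  have hdir' : DirectedOn (· ≤ ·) (D ∩ Set.Ici d) := by
    rintro x ⟨hx, hdx⟩ y ⟨hy, _⟩
    obtain ⟨t, ht, hxt, hyt⟩ := hdir x hx y hy
    exact ⟨t, ⟨ht, le_trans (Set.mem_Ici.1 hdx) hxt⟩, hxt, hyt⟩
  have ha' : IsLUB (D ∩ Set.Ici d) a := by
    refine ⟨fun x hx => ha.1 hx.1, fun b hb => ha.2 fun x hx => ?_⟩
    obtain ⟨t, ht, hxt, hdt⟩ := hdir x hx d hd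
    exact hxt.trans (hb ⟨ht, hdt⟩)
  have hdom : D ∩ Set.Ici d ⊆ f.Dom := fun x hx => hm.1 hx.2 hdf
  refine hB ?_ ?_ ?_ (hf.2 _ hdom ⟨d, hd, le_rfl⟩ hdir' a ha' z hz)
  · rintro y ⟨x, hx, hy⟩
    exact hD hx.1 y hy
  · obtain ⟨y, hy⟩ := Part.dom_iff_mem.1 hdf
    exact ⟨y, d, ⟨hd, le_rfl⟩, hy⟩
  · rintro y ⟨x, hx, hy⟩ y' ⟨x', hx', hy'⟩
    obtain ⟨t, ht, hxt, hxt'⟩ := hdir' x hx x' hx'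
    obtain ⟨u, hu, hyu⟩ := hm.exists_le hxt hy
    obtain ⟨u', hu', hyu'⟩ := hm.exists_le hxt' hy'
    exact ⟨u, ⟨t, ht, hu⟩, hyu, Part.mem_unique hu' hu ▸ hyu'⟩

theorem PartialMonotone.isLowerSet_preimage {f : S →. S} (hm : PartialMonotone f) {B : Set S}
    (hB : IsLowerSet B) : IsLowerSet {x | ∀ z ∈ f x, z ∈ B} := by
  intro x y hyx hx z hz
  obtain ⟨t, ht, hzt⟩ := hm.exists_le hyx hz
  exact hB hzt (hx t ht)

end Words

/-! ### Runs and covers -/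

namespace OrdFunTS

variable {S : Type u} [PartialOrder S] (T : OrdFunTS S)

/-- The partial map defined by a word over the transition maps of `T`. -/
abbrev word (w : List T.F) : S →. S := wordMap (w.map Subtype.val)

/-- The states reached from `s` by firing the words of `L`. -/
def runs (L : Language T.F) (s : S) : Set S := {z | ∃ w ∈ L, z ∈ T.word w s}

theorem partialMonotone_word (w : List T.F) : PartialMonotone (T.word w) := by
  refine partialMonotone_wordMap fun f hf => ?_
  obtain ⟨g, -, rfl⟩ := List.mem_map.1 hf
  exact T.mono _ g.2

theorem mem_compositions_iff {g : S →. S} :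
    g ∈ compositions T.F ↔ ∃ w : List T.F, g = T.word w := by
  constructor
  · rintro ⟨w, hw, rfl⟩
    lift w to List T.F using hw
    exact ⟨w, rfl⟩
  · rintro ⟨w, rfl⟩
    refine ⟨_, fun f hf => ?_, rfl⟩
    obtain ⟨g, -, rfl⟩ := List.mem_map.1 hf
    exact g.2

theorem reflTransGen_step_iff {s z : S} :
    Relation.ReflTransGen T.Step s z ↔ ∃ w : List T.F, z ∈ T.word w s := by
  constructor
  · intro h
    induction h using Relation.ReflTransGen.head_induction_on with
    | refl => exact ⟨[], mem_wordMap_nil.2 rfl⟩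
    | head h _ ih =>
      obtain ⟨f, hf, hz⟩ := h
      obtain ⟨w, hw⟩ := ih
      exact ⟨⟨f, hf⟩ :: w, mem_wordMap_cons.2 ⟨_, hz, hw⟩⟩
  · rintro ⟨w, hw⟩
    induction w generalizing s with
    | nil => rw [mem_wordMap_nil.1 hw]
    | cons f w ih =>
      obtain ⟨t, ht, hw⟩ := mem_wordMap_cons.1 hw
      exact Relation.ReflTransGen.head ⟨f.1, f.2, ht⟩ (ih hw)

theorem mem_cover {s y : S} : y ∈ T.cover s ↔ ∃ w : List T.F, ∃ z ∈ T.word w s, y ≤ z := by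
  constructor
  · rintro ⟨t, ⟨r, ⟨_, rfl, hrs⟩, hrt⟩, hyt⟩
    obtain ⟨w, hw⟩ := T.reflTransGen_step_iff.1 hrt
    obtain ⟨z, hz, htz⟩ := (T.partialMonotone_word w).exists_le hrs hw
    exact ⟨w, z, hz, hyt.trans htz⟩
  · rintro ⟨w, z, hz, hyz⟩
    exact ⟨z, ⟨s, subset_down _ rfl, T.reflTransGen_step_iff.2 ⟨w, hz⟩⟩, hyz⟩

theorem isLowerSet_cover (s : S) : IsLowerSet (T.cover s) := isLowerSet_down _

theorem self_mem_cover (s : S) : s ∈ T.cover s :=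
  T.mem_cover.2 ⟨[], s, mem_wordMap_nil.2 rfl, le_rfl⟩

theorem runs_subset_cover (L : Language T.F) (s : S) : T.runs L s ⊆ T.cover s :=
  fun z ⟨w, _, hz⟩ => T.mem_cover.2 ⟨w, z, hz, le_rfl⟩

/-- A lower set closed under the transitions contains the cover of each of its points. -/
theorem cover_subset_of_post_subset {B : Set S} (hB : IsLowerSet B) (hpost : T.post B ⊆ B) {s : S}
    (hs : s ∈ B) : T.cover s ⊆ B := by
  intro y hy
  obtain ⟨w, z, hz, hyz⟩ := T.mem_cover.1 hy
  refine hB hyz ?_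
  clear hyz hy
  induction w generalizing s with
  | nil => rwa [mem_wordMap_nil.1 hz]
  | cons f w ih =>
    obtain ⟨t, ht, hz⟩ := mem_wordMap_cons.1 hz
    exact ih (hpost ⟨s, hs, f.1, f.2, ht⟩) hz

/-- The cover of `s` is exhausted, up to domination, by the runs along a bounded language. -/
def CoverBounded (s : S) : Prop :=
  ∃ ws : List (List T.F), T.cover s ⊆ down (T.runs (boundedLanguage ws) s)

/-- The Scott closure of the cover of `s` is exhausted by the runs along a bounded language. -/
def CloverBounded (s : S) : Prop :=
  ∃ ws : List (List T.F), T.cover s ⊆ scottClosure (T.runs (boundedLanguage ws) s)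

end OrdFunTS

/-! ### Products with rl-automata -/

section Sync

variable {S : Type u} [PartialOrder S] {Q : Type}

theorem monotone_state : Monotone (SyncState.state : SyncState S Q → S) := fun _ _ h => h.1

/-- Least upper bounds of a nonempty set of states with a common control component `q` are least
upper bounds of the projection, with control component `q`. -/
theorem isLUB_syncState_iff {D : Set (SyncState S Q)} (hne : D.Nonempty) {q : Q}
    (hq : ∀ p ∈ D, p.control = q) {a : SyncState S Q} :
    IsLUB D a ↔ IsLUB (SyncState.state '' D) a.state ∧ a.control = q := by
  obtain ⟨p₀, hp₀⟩ := hne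
  constructor
  · intro h
    have hc : a.control = q := by rw [← hq p₀ hp₀]; exact (h.1 hp₀).2.symm
    refine ⟨⟨?_, fun b hb => ?_⟩, hc⟩
    · rintro _ ⟨p, hp, rfl⟩
      exact (h.1 hp).1
    · exact (h.2 (show (⟨b, q⟩ : SyncState S Q) ∈ upperBounds D from
        fun p hp => ⟨hb ⟨p, hp, rfl⟩, hq p hp⟩)).1
  · rintro ⟨h, hc⟩
    refine ⟨fun p hp => ⟨h.1 ⟨p, hp, rfl⟩, (hq p hp).trans hc.symm⟩, fun b hb => ?_⟩
    refine ⟨h.2 ?_, ?_⟩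
    · rintro _ ⟨p, hp, rfl⟩
      exact (hb hp).1
    · rw [hc, ← hq p₀ hp₀]
      exact (hb hp₀).2

theorem control_eq_of_directedOn {D : Set (SyncState S Q)} (hD : DirectedOn (· ≤ ·) D)
    {p p' : SyncState S Q} (hp : p ∈ D) (hp' : p' ∈ D) : p.control = p'.control := by
  obtain ⟨r, -, h, h'⟩ := hD p hp p' hp'
  exact h.2.trans h'.2.symm

theorem directedOn_image_state {D : Set (SyncState S Q)} (hD : DirectedOn (· ≤ ·) D) :
    DirectedOn (· ≤ ·) (SyncState.state '' D) :=
  directedOn_image.2 (hD.mono fun _ _ h => monotone_state h)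

theorem isLUB_state_of_isLUB {D : Set (SyncState S Q)} (hne : D.Nonempty)
    (hD : DirectedOn (· ≤ ·) D) {a : SyncState S Q} (ha : IsLUB D a) :
    IsLUB (SyncState.state '' D) a.state := by
  obtain ⟨p, hp⟩ := hne
  exact ((isLUB_syncState_iff ⟨p, hp⟩ fun p' hp' => control_eq_of_directedOn hD hp' hp).1 ha).1

theorem scottContinuous_state : ScottContinuous (SyncState.state : SyncState S Q → S) :=
  fun _ hne hD _ ha => isLUB_state_of_isLUB hne hD ha

theorem isLUB_image_mk {D : Set S} (hne : D.Nonempty) (q : Q) {a : S} :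
    IsLUB ((fun s => (⟨s, q⟩ : SyncState S Q)) '' D) ⟨a, q⟩ ↔ IsLUB D a := by
  rw [isLUB_syncState_iff (hne.image _) (q := q) (by rintro _ ⟨s, _, rfl⟩; rfl), Set.image_image]
  simp

theorem directedOn_image_mk {D : Set S} (hD : DirectedOn (· ≤ ·) D) (q : Q) :
    DirectedOn (· ≤ ·) ((fun s => (⟨s, q⟩ : SyncState S Q)) '' D) :=
  directedOn_image.2 (hD.mono fun _ _ h => ⟨h, rfl⟩)

theorem wayBelow_syncState_iff {x y : SyncState S Q} :
    WayBelow x y ↔ WayBelow x.state y.state ∧ x.control = y.control := by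
  constructor
  · intro h
    refine ⟨fun D hne hD a ha hya => ?_, ?_⟩
    · obtain ⟨_, ⟨z, hz, rfl⟩, hxz⟩ := h _ (hne.image _) (directedOn_image_mk hD y.control) _
        ((isLUB_image_mk hne y.control).2 ha) ⟨hya, rfl⟩
      exact ⟨z, hz, hxz.1⟩
    · obtain ⟨_, rfl, hz⟩ := h {y} (Set.singleton_nonempty y) (directedOn_singleton _) y
        isLUB_singleton le_rfl
      exact hz.2
  · rintro ⟨h, hc⟩ D hne hD a ha hya
    obtain ⟨_, ⟨z, hz, rfl⟩, hxz⟩ := h _ (hne.image _) (directedOn_image_state hD) _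
      (isLUB_state_of_isLUB hne hD ha) hya.1
    exact ⟨z, hz, hxz, hc.trans (hya.2.trans (ha.1 hz).2.symm)⟩

theorem isContinuousDcwo_syncState [Finite Q] (h : IsContinuousDcwo S) :
    IsContinuousDcwo (SyncState S Q) := by
  obtain ⟨hdcpo, hcont, hwqo⟩ := h
  refine ⟨fun D hne hD => ?_, fun x => ?_, ?_⟩
  · obtain ⟨a, ha⟩ := hdcpo _ (hne.image _) (directedOn_image_state hD)
    obtain ⟨p, hp⟩ := hne
    exact ⟨⟨a, p.control⟩, (isLUB_syncState_iff ⟨p, hp⟩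
      fun p' hp' => control_eq_of_directedOn hD hp' hp).2 ⟨ha, rfl⟩⟩
  · have heq : {y | WayBelow y x} =
        (fun s => (⟨s, x.control⟩ : SyncState S Q)) '' {y | WayBelow y x.state} := by
      ext ⟨y, q⟩
      rw [Set.mem_ofPred_eq, wayBelow_syncState_iff]
      constructor
      · rintro ⟨hy, rfl⟩
        exact ⟨y, hy, rfl⟩
      · rintro ⟨y', hy, h⟩
        cases h
        exact ⟨hy, rfl⟩
    obtain ⟨hne, hdir, hlub⟩ := hcont x.state
    rw [heq]
    exact ⟨hne.image _, directedOn_image_mk hdir _, (isLUB_image_mk hne _).2 hlub⟩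
  · refine ⟨fun f => ?_⟩
    obtain ⟨i, j, hij, hs, hc⟩ := hwqo.wqo.prod (Finite.wellQuasiOrdered (α := Q) (· = ·))
      fun n => ((f n).state, (f n).control)
    exact ⟨i, j, hij, hs, hc⟩

theorem partialContinuous_syncMap {f : S →. S} (hm : PartialMonotone f)
    (hf : PartialContinuous f) (d : Q → Option Q) : PartialContinuous (syncMap f d) := by
  have hm' := syncMap_partialMonotone hm d
  refine ⟨isScottOpen_iff.2 ⟨hm'.1, fun D hne hD a ha had => ?_⟩, ?_⟩
  · obtain ⟨a', ha'⟩ := Part.dom_iff_mem.1 had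
    rw [mem_syncMap] at ha'
    obtain ⟨_, ⟨p, hp, rfl⟩, hpf⟩ := (isScottOpen_iff.1 hf.1).2 (hne.image _)
      (directedOn_image_state hD) (isLUB_state_of_isLUB hne hD ha)
      (Part.dom_iff_mem.2 ⟨_, ha'.1⟩)
    obtain ⟨s, hs⟩ := Part.dom_iff_mem.1 hpf
    exact ⟨p, hp, Part.dom_iff_mem.2 ⟨⟨s, a'.control⟩,
      mem_syncMap.2 ⟨hs, (ha.1 hp).2 ▸ ha'.2⟩⟩⟩
  · intro D hDdom hne hD a ha b hb
    rw [mem_syncMap] at hb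
    have hcon : ∀ p ∈ D, d p.control = some b.control := fun p hp => (ha.1 hp).2 ▸ hb.2
    have himage : SyncState.state '' {y | ∃ x ∈ D, y ∈ syncMap f d x} =
        {y | ∃ x ∈ SyncState.state '' D, y ∈ f x} := by
      ext y
      constructor
      · rintro ⟨r, ⟨p, hp, hr⟩, rfl⟩
        exact ⟨_, ⟨p, hp, rfl⟩, (mem_syncMap.1 hr).1⟩
      · rintro ⟨_, ⟨p, hp, rfl⟩, hy⟩
        exact ⟨⟨y, b.control⟩, ⟨p, hp, mem_syncMap.2 ⟨hy, hcon p hp⟩⟩, rfl⟩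
    have hne' : {y | ∃ x ∈ D, y ∈ syncMap f d x}.Nonempty := by
      obtain ⟨p, hp⟩ := hne
      obtain ⟨y, hy⟩ := Part.dom_iff_mem.1 (hDdom hp)
      exact ⟨y, p, hp, hy⟩
    refine (isLUB_syncState_iff hne' (q := b.control) ?_).2 ⟨?_, rfl⟩
    · rintro y ⟨p, hp, hy⟩
      have := (mem_syncMap.1 hy).2
      rw [hcon p hp] at this
      exact (Option.some.inj this).symm
    · rw [himage]
      refine hf.2 _ ?_ (hne.image _) (directedOn_image_state hD) _ (isLUB_state_of_isLUB hne hD ha)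
        _ hb.1
      rintro _ ⟨p, hp, rfl⟩
      obtain ⟨y, hy⟩ := Part.dom_iff_mem.1 (hDdom hp)
      exact Part.dom_iff_mem.2 ⟨_, (mem_syncMap.1 hy).1⟩

variable {T : OrdFunTS S} (M : RLAutomaton T.F)

theorem OrdFunTS.IsComplete.sync (hT : T.IsComplete) : (T.sync M).IsComplete := by
  have := M.finiteQ
  refine ⟨isContinuousDcwo_syncState hT.1, ?_⟩
  rintro _ ⟨f, _, rfl⟩
  exact partialContinuous_syncMap (T.mono _ f.2) (hT.2 _ f.2) _

/-- A run of the transition system along a word read by the automaton is a run of the product. -/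
theorem reflTransGen_sync {w : List T.F} {s z : S} {q q' : M.Q} (hz : z ∈ T.word w s)
    (hq : w.foldlM M.δ q = some q') :
    Relation.ReflTransGen (T.sync M).Step ⟨s, q⟩ ⟨z, q'⟩ := by
  induction w generalizing s q with
  | nil =>
    obtain rfl := mem_wordMap_nil.1 hz
    obtain rfl : q = q' := by simpa using hq
    exact .refl
  | cons f w ih =>
    obtain ⟨t, ht, hz⟩ := mem_wordMap_cons.1 hz
    rw [List.foldlM_cons, Option.bind_eq_bind, Option.bind_eq_some_iff] at hq
    obtain ⟨r, hr, hq⟩ := hq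
    exact .head ⟨_, ⟨f, ⟨q, by rw [hr]; rfl⟩, rfl⟩, mem_syncMap.2 ⟨ht, hr⟩⟩ (ih hz hq)

theorem state_image_cover_sync_subset (s : S) :
    SyncState.state '' (T.sync M).cover ⟨s, M.q₀⟩ ⊆ T.cover s := by
  rw [Set.image_subset_iff]
  refine (T.sync M).cover_subset_of_post_subset
    ((T.isLowerSet_cover s).preimage monotone_state) ?_ (T.self_mem_cover s)
  rintro p' ⟨p, hp, _, ⟨f, _, rfl⟩, hpp'⟩
  obtain ⟨w, z, hz, hle⟩ := T.mem_cover.1 hp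
  obtain ⟨t, ht, hle'⟩ := (T.mono _ f.2).exists_le hle (mem_syncMap.1 hpp').1
  refine T.mem_cover.2 ⟨w ++ [f], t, ?_, hle'⟩
  rw [OrdFunTS.word, List.map_append, mem_wordMap_append]
  exact ⟨z, hz, mem_wordMap_cons.2 ⟨t, ht, mem_wordMap_nil.2 rfl⟩⟩

theorem isLowerSet_state_image {B : Set (SyncState S Q)} (hB : IsLowerSet B) :
    IsLowerSet (SyncState.state '' B) := by
  rintro _ b hb ⟨p, hp, rfl⟩
  exact ⟨⟨b, p.control⟩, hB ⟨hb, rfl⟩ hp, rfl⟩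

theorem runs_subset_state_image_cover_sync {ws : List (List T.F)}
    (hM : ∀ w : List T.F, (w.foldlM M.δ M.q₀).isSome ↔ ∃ v ∈ boundedLanguage ws, w <+: v) (s : S) :
    T.runs (boundedLanguage ws) s ⊆ SyncState.state '' (T.sync M).cover ⟨s, M.q₀⟩ := by
  rintro z ⟨w, hw, hz⟩
  obtain ⟨q, hq⟩ := Option.isSome_iff_exists.1 ((hM w).2 ⟨w, hw, List.prefix_rfl⟩)
  exact ⟨⟨z, q⟩, subset_down _ ⟨_, subset_down _ rfl, reflTransGen_sync M hz hq⟩, rfl⟩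

/-- The projection of the product onto the transition system is a flattening. Different transition
maps of the product come from different letters, and the automaton reads the letters of a fireable
word, so flatness follows by pulling back a bounded language that contains all prefixes of the words
allowed by the automaton. -/
theorem isFlattening_state (s : S) :
    IsFlattening (T.sync M) T SyncState.state ⟨s, M.q₀⟩ := by
  have hex : ∀ h : (T.sync M).F, ∃ f : T.F, h.1 = syncMap f.1 fun q => M.δ q f := by
    rintro ⟨_, f, _, rfl⟩
    exact ⟨f, rfl⟩
  choose ψ hψ using hex
  have hinj : Function.Injective ψ := fun h h' heq => Subtype.ext (by rw [hψ, hψ, heq])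
  refine ⟨?_, ψ, fun h p p' hp => ?_⟩
  · obtain ⟨ws, hws⟩ := M.isRL
    refine ⟨(ws.flatMap fun v => v :: v.map fun a => [a]).map
      fun v => v.filterMap (Function.partialInv ψ), fun w hw => ?_⟩
    have hread : ∀ (w : List (T.sync M).F) (p z : SyncState S M.Q), z ∈ (T.sync M).word w p →
        (w.map ψ).foldlM M.δ p.control = some z.control := by
      intro w
      induction w with
      | nil => intro p z hz; rw [mem_wordMap_nil.1 hz]; rfl
      | cons h w ih =>
        intro p z hz
        obtain ⟨t, ht, hz⟩ := mem_wordMap_cons.1 hz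
        rw [hψ, mem_syncMap] at ht
        rw [List.map_cons, List.foldlM_cons, ht.2]
        exact ih t z hz
    obtain ⟨z, hz⟩ := Part.dom_iff_mem.1 hw
    obtain ⟨v, hv, hwv⟩ := (hws (w.map ψ)).1 (by rw [hread w _ z hz]; rfl)
    have hback : (w.map ψ).filterMap (Function.partialInv ψ) = w := by
      rw [List.filterMap_map]
      have : Function.partialInv ψ ∘ ψ = some := funext (Function.partialInv_left hinj)
      rw [this, List.filterMap_some]
    rw [← hback]
    exact mem_boundedLanguage_map List.filterMap_nil (fun _ _ => List.filterMap_append)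
      (mem_boundedLanguage_of_prefix hv hwv)
  · rw [hψ, mem_syncMap] at hp
    exact hp.1

end Sync

/-! ### Flattability in terms of bounded languages -/

section Flattable

variable {S : Type u} [PartialOrder S] {T : OrdFunTS S}

/-- The image of the cover of a flattening is dominated by the runs along a bounded language. -/
theorem IsFlattening.image_cover_subset {S₁ : Type u} [PartialOrder S₁] {T₁ : OrdFunTS S₁}
    {φ : S₁ → S} {s₁ : S₁} (h : IsFlattening T₁ T φ s₁) (hφ : Monotone φ) {s : S} (hs : φ s₁ ≤ s) :
    ∃ ws : List (List T.F), φ '' T₁.cover s₁ ⊆ down (T.runs (boundedLanguage ws) s) := by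
  obtain ⟨⟨ws, hws⟩, ψ, hψ⟩ := h
  refine ⟨ws.map (List.map ψ), ?_⟩
  rintro _ ⟨y, hy, rfl⟩
  obtain ⟨w, z, hz, hyz⟩ := T₁.mem_cover.1 hy
  have hrun : ∀ (w : List T₁.F) (r z : S₁), z ∈ T₁.word w r → φ z ∈ T.word (w.map ψ) (φ r) := by
    intro w
    induction w with
    | nil => intro r z hz; rw [mem_wordMap_nil.1 hz]; exact mem_wordMap_nil.2 rfl
    | cons f w ih =>
      intro r z hz
      obtain ⟨t, ht, hz⟩ := mem_wordMap_cons.1 hz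
      exact mem_wordMap_cons.2 ⟨φ t, hψ f r t ht, ih t z hz⟩
  obtain ⟨z', hz', hle⟩ := (T.partialMonotone_word _).exists_le hs (hrun w s₁ z hz)
  exact ⟨z', ⟨_, mem_boundedLanguage_map List.map_nil (fun _ _ => List.map_append)
    (hws w (Part.dom_iff_mem.2 ⟨z, hz⟩)), hz'⟩, (hφ hyz).trans hle⟩

theorem CoverFlattable.weakly {s : S} (h : CoverFlattable T s) : WeaklyCoverFlattable T s := by
  obtain ⟨S₁, _, T₁, φ, s₁, hfl, hφ, hs, hc⟩ := h
  exact ⟨S₁, _, T₁, φ, s₁, hfl, hφ, hs.le, hc.le⟩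

theorem WeaklyCoverFlattable.coverBounded {s : S} (h : WeaklyCoverFlattable T s) :
    T.CoverBounded s := by
  obtain ⟨S₁, _, T₁, φ, s₁, hfl, hφ, hs, hc⟩ := h
  obtain ⟨ws, hws⟩ := hfl.image_cover_subset hφ hs
  exact ⟨ws, hc.trans ((down_subset_iff (isLowerSet_down _)).2 hws)⟩

theorem OrdFunTS.CoverBounded.strongly {s : S} (h : T.CoverBounded s) :
    StronglyCoverFlattable T s := by
  obtain ⟨ws, hws⟩ := h
  obtain ⟨M, hM⟩ := exists_rlAutomaton ws
  refine ⟨M, (hws.trans ?_).antisymm (state_image_cover_sync_subset M s)⟩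
  exact (down_subset_iff (isLowerSet_state_image ((T.sync M).isLowerSet_cover _))).2
    (runs_subset_state_image_cover_sync M hM s)

theorem StronglyCoverFlattable.coverFlattable {s : S} (h : StronglyCoverFlattable T s) :
    CoverFlattable T s := by
  obtain ⟨M, hM⟩ := h
  refine ⟨_, _, T.sync M, SyncState.state, ⟨s, M.q₀⟩, isFlattening_state M s, monotone_state, rfl,
    ?_⟩
  rw [← hM]
  exact (subset_down _).antisymm ((down_subset_iff (T.isLowerSet_cover s)).2 subset_rfl)

theorem CloverFlattable.weakly {s : S} (h : CloverFlattable T s) : WeaklyCloverFlattable T s := by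
  obtain ⟨S₁, _, T₁, φ, s₁, hT₁, hfl, hφ, hs, hc⟩ := h
  exact ⟨S₁, _, T₁, φ, s₁, hT₁, hfl, hφ, hs.le, hc.le⟩

theorem WeaklyCloverFlattable.cloverBounded {s : S} (h : WeaklyCloverFlattable T s) :
    T.CloverBounded s := by
  obtain ⟨S₁, _, T₁, φ, s₁, hT₁, hfl, hφ, hs, hc⟩ := h
  obtain ⟨ws, hws⟩ := hfl.image_cover_subset hφ.monotone hs
  refine ⟨ws, (subset_scottClosure _).trans (hc.trans (scottClosure_subset_iff.2 ?_))⟩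
  exact (image_scottClosure_subset hφ _).trans
    (scottClosure_subset_iff.2 (hws.trans (down_subset_scottClosure _)))

theorem OrdFunTS.CloverBounded.strongly {s : S} (h : T.CloverBounded s) :
    StronglyCloverFlattable T s := by
  obtain ⟨ws, hws⟩ := h
  obtain ⟨M, hM⟩ := exists_rlAutomaton ws
  refine ⟨M, (scottClosure_subset_iff.2 (hws.trans (scottClosure_mono ?_))).antisymm
    (scottClosure_subset_iff.2 ((image_scottClosure_subset scottContinuous_state _).trans
      (scottClosure_mono (state_image_cover_sync_subset M s))))⟩
  exact (runs_subset_state_image_cover_sync M hM s).trans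
    (Set.image_mono (subset_scottClosure _))

theorem StronglyCloverFlattable.cloverFlattable {s : S} (hT : T.IsComplete)
    (h : StronglyCloverFlattable T s) : CloverFlattable T s := by
  obtain ⟨M, hM⟩ := h
  exact ⟨_, _, T.sync M, SyncState.state, ⟨s, M.q₀⟩, hT.sync M, isFlattening_state M s,
    scottContinuous_state, rfl, hM⟩

end Flattable

/-! ### The ideal completion -/

section Completion

variable {X : Type u} [PartialOrder X]

theorem eta_le_iff {x : X} {C : Order.Ideal X} : eta x ≤ C ↔ x ∈ C := Order.Ideal.principal_le_iff

/-- The union of a directed set of ideals. -/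
def directedUnion (D : Set (Order.Ideal X)) (hne : D.Nonempty) (hD : DirectedOn (· ≤ ·) D) :
    Order.Ideal X where
  carrier := {x | ∃ C ∈ D, x ∈ C}
  lower' := fun _ _ hba ⟨C, hC, ha⟩ => ⟨C, hC, C.lower hba ha⟩
  nonempty' := by
    obtain ⟨C, hC⟩ := hne
    obtain ⟨x, hx⟩ := C.nonempty
    exact ⟨x, C, hC, hx⟩
  directed' := by
    rintro x ⟨C, hC, hx⟩ y ⟨C', hC', hy⟩
    obtain ⟨E, hE, hCE, hCE'⟩ := hD C hC C' hC'
    obtain ⟨z, hz, hxz, hyz⟩ := E.directed x (hCE hx) y (hCE' hy)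
    exact ⟨z, ⟨E, hE, hz⟩, hxz, hyz⟩

theorem isLUB_directedUnion {D : Set (Order.Ideal X)} (hne : D.Nonempty)
    (hD : DirectedOn (· ≤ ·) D) : IsLUB D (directedUnion D hne hD) :=
  ⟨fun C hC _ hx => ⟨C, hC, hx⟩, fun _ hE _ ⟨_, hC, hx⟩ => hE hC hx⟩

theorem mem_iff_of_isLUB {D : Set (Order.Ideal X)} (hne : D.Nonempty)
    (hD : DirectedOn (· ≤ ·) D) {E : Order.Ideal X} (hE : IsLUB D E) {x : X} :
    x ∈ E ↔ ∃ C ∈ D, x ∈ C := by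
  rw [hE.unique (isLUB_directedUnion hne hD)]
  rfl

theorem directedOn_eta_image (C : Order.Ideal X) :
    DirectedOn (· ≤ ·) (eta '' (C : Set X)) :=
  directedOn_image.2 (C.directed.mono fun _ _ h => Order.Ideal.principal_le_iff.2 h)

theorem isLUB_eta_image (C : Order.Ideal X) : IsLUB (eta '' (C : Set X)) C := by
  refine ⟨?_, fun E hE x hx => eta_le_iff.1 (hE ⟨x, hx, rfl⟩)⟩
  rintro _ ⟨x, hx, rfl⟩
  exact eta_le_iff.2 hx

theorem wayBelow_ideal_iff {B C : Order.Ideal X} : WayBelow B C ↔ ∃ x ∈ C, B ≤ eta x := by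
  constructor
  · intro h
    obtain ⟨_, ⟨x, hx, rfl⟩, hB⟩ := h _ (C.nonempty.image eta) (directedOn_eta_image C) C
      (isLUB_eta_image C) le_rfl
    exact ⟨x, hx, hB⟩
  · rintro ⟨x, hx, hB⟩ D hne hD E hE hCE
    obtain ⟨F, hF, hxF⟩ := (mem_iff_of_isLUB hne hD hE).1 (hCE hx)
    exact ⟨F, hF, hB.trans (eta_le_iff.2 hxF)⟩

theorem isContinuousDcwo_ideal (hX : IsOmegaSqWpo X) : IsContinuousDcwo (Order.Ideal X) := by
  refine ⟨fun D hne hD => ⟨_, isLUB_directedUnion hne hD⟩, fun C => ?_,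
    wellQuasiOrderedLE_ideal hX⟩
  have hsub : eta '' (C : Set X) ⊆ {B | WayBelow B C} := by
    rintro _ ⟨x, hx, rfl⟩
    exact wayBelow_ideal_iff.2 ⟨x, hx, le_rfl⟩
  refine ⟨(C.nonempty.image eta).mono hsub, fun A hA B hB => ?_, fun B hB => ?_, fun E hE => ?_⟩
  · obtain ⟨x, hx, hAx⟩ := wayBelow_ideal_iff.1 hA
    obtain ⟨y, hy, hBy⟩ := wayBelow_ideal_iff.1 hB
    obtain ⟨z, hz, hxz, hyz⟩ := C.directed x hx y hy
    exact ⟨eta z, hsub ⟨z, hz, rfl⟩, hAx.trans (eta_le_iff.2 hxz), hBy.trans (eta_le_iff.2 hyz)⟩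
  · obtain ⟨x, hx, hBx⟩ := wayBelow_ideal_iff.1 hB
    exact hBx.trans (eta_le_iff.2 hx)
  · exact (isLUB_eta_image C).2 fun B hB => hE (hsub hB)

theorem mem_idealMap {f : X →. X} {hf : PartialMonotone f} {C D : Order.Ideal X} :
    D ∈ idealMap f hf C ↔ ∀ y, y ∈ D ↔ ∃ x ∈ C, ∃ z ∈ f x, y ≤ z := by
  constructor
  · rintro ⟨_, rfl⟩ y
    rfl
  · intro h
    obtain ⟨y, hy⟩ := D.nonempty
    obtain ⟨x, hx, z, hz, -⟩ := (h y).1 hy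
    exact ⟨⟨x, hx, Part.dom_iff_mem.2 ⟨z, hz⟩⟩, Order.Ideal.ext (Set.ext fun y => (h y).symm)⟩

theorem partialContinuous_idealMap (f : X →. X) (hf : PartialMonotone f) :
    PartialContinuous (idealMap f hf) := by
  refine ⟨isScottOpen_iff.2 ⟨(idealMap_partialMonotone f hf).1, fun D hne hD E hE hdom => ?_⟩,
    fun D hDdom hne hD E hE B hB => ⟨?_, fun B' hB' y hy => ?_⟩⟩
  · obtain ⟨x, hx, hxf⟩ := hdom
    obtain ⟨C, hC, hxC⟩ := (mem_iff_of_isLUB hne hD hE).1 hx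
    exact ⟨C, hC, x, hxC, hxf⟩
  · rintro A ⟨C, hC, hA⟩
    exact (idealMap_partialMonotone f hf).2 _ _ _ _ (hE.1 hC) hA hB
  · obtain ⟨x, hx, z, hz, hyz⟩ := (mem_idealMap.1 hB y).1 hy
    obtain ⟨C, hC, hxC⟩ := (mem_iff_of_isLUB hne hD hE).1 hx
    obtain ⟨A, hA⟩ := Part.dom_iff_mem.1 (hDdom hC)
    exact hB' ⟨C, hC, hA⟩ ((mem_idealMap.1 hA y).2 ⟨x, hxC, z, hz, hyz⟩)

theorem isComplete_completion (T : OrdFunTS X) (hX : IsOmegaSqWpo X) : T.completion.IsComplete := by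
  refine ⟨isContinuousDcwo_ideal hX, ?_⟩
  rintro _ ⟨f, rfl⟩
  exact partialContinuous_idealMap _ _

/-- An ideal is in the Scott closure of a set of ideals iff each of its points is in one of them. -/
theorem mem_scottClosure_ideal {A : Set (Order.Ideal X)} {C : Order.Ideal X} :
    C ∈ scottClosure A ↔ ∀ x ∈ C, ∃ B ∈ A, x ∈ B := by
  constructor
  · intro h
    refine scottClosure_minimal (B := {C : Order.Ideal X | ∀ x ∈ C, ∃ B ∈ A, x ∈ B})
      (fun B hB x hx => ⟨B, hB, hx⟩)
      (fun C E (hEC : E ≤ C) hC x hx => hC x (hEC hx)) (fun D hDs hne hD E hE x hx => ?_) h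
    obtain ⟨C, hC, hxC⟩ := (mem_iff_of_isLUB hne hD hE).1 hx
    exact hDs hC x hxC
  · intro h
    refine dirSupClosed_scottClosure A ?_ (C.nonempty.image eta) (directedOn_eta_image C)
      (isLUB_eta_image C)
    rintro _ ⟨x, hx, rfl⟩
    obtain ⟨B, hB, hxB⟩ := h x hx
    exact isLowerSet_scottClosure A (eta_le_iff.2 hxB) (subset_scottClosure A hB)

/-- The directed least upper bounds of a lower set of ideals form its Scott closure. -/
theorem dirLubs_eq_scottClosure {A : Set (Order.Ideal X)} (hA : IsLowerSet A) :
    dirLubs A = scottClosure A := by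
  ext C
  constructor
  · rintro ⟨D, hDA, hne, hD, hC⟩
    exact dirSupClosed_scottClosure A (hDA.trans (subset_scottClosure A)) hne hD hC
  · intro hC
    refine ⟨eta '' (C : Set X), ?_, C.nonempty.image eta, directedOn_eta_image C,
      isLUB_eta_image C⟩
    rintro _ ⟨x, hx, rfl⟩
    obtain ⟨B, hB, hxB⟩ := mem_scottClosure_ideal.1 hC x hx
    exact hA (eta_le_iff.2 hxB) hB

theorem clover_eq_maxSet_scottClosure {T : OrdFunTS (Order.Ideal X)} {C : Order.Ideal X} :
    T.clover C = maxSet (scottClosure (T.cover C)) := by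
  rw [OrdFunTS.clover, dirLubs_eq_scottClosure (T.isLowerSet_cover C)]

variable (T : OrdFunTS X)

/-- The transition map of the completion that extends a given transition map. -/
def extend (f : T.F) : T.completion.F := ⟨idealMap f.1 (T.mono f.1 f.2), f, rfl⟩

theorem extend_surjective : Function.Surjective (extend T) := by
  rintro ⟨_, f, rfl⟩
  exact ⟨f, rfl⟩

/-- A run of the completion on an ideal consists of the points below runs on its points. -/
theorem mem_word_completion {w : List T.F} {C D : Order.Ideal X} :
    D ∈ T.completion.word (w.map (extend T)) C ↔
      ∀ y, y ∈ D ↔ ∃ x ∈ C, ∃ z ∈ T.word w x, y ≤ z := by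
  have hdown : ∀ {C D : Order.Ideal X},
      D ∈ T.completion.word (w.map (extend T)) C →
      ∀ y, y ∈ D ↔ ∃ x ∈ C, ∃ z ∈ T.word w x, y ≤ z := by
    induction w with
    | nil =>
      intro C D hD y
      rw [mem_wordMap_nil.1 hD]
      exact ⟨fun h => ⟨y, h, y, mem_wordMap_nil.2 rfl, le_rfl⟩,
        fun ⟨x, hx, z, hz, hyz⟩ => C.lower hyz (mem_wordMap_nil.1 hz ▸ hx)⟩
    | cons f w ih =>
      intro C D hD y
      obtain ⟨E, hE, hD⟩ := mem_wordMap_cons.1 hD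
      rw [ih hD y]
      constructor
      · rintro ⟨e, he, z, hz, hyz⟩
        obtain ⟨x, hx, t, ht, het⟩ := (mem_idealMap.1 hE e).1 he
        obtain ⟨z', hz', hzz'⟩ := (T.partialMonotone_word w).exists_le het hz
        exact ⟨x, hx, z', mem_wordMap_cons.2 ⟨t, ht, hz'⟩, hyz.trans hzz'⟩
      · rintro ⟨x, hx, z, hz, hyz⟩
        obtain ⟨t, ht, hz⟩ := mem_wordMap_cons.1 hz
        exact ⟨t, (mem_idealMap.1 hE t).2 ⟨x, hx, t, ht, le_rfl⟩, z, hz, hyz⟩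
  refine ⟨hdown, fun h => ?_⟩
  have hdom : ∀ (w : List T.F) (C : Order.Ideal X), (∃ x ∈ C, ∃ z, z ∈ T.word w x) →
      ∃ D, D ∈ T.completion.word (w.map (extend T)) C := by
    intro w
    induction w with
    | nil => exact fun C _ => ⟨C, mem_wordMap_nil.2 rfl⟩
    | cons f w ih =>
      rintro C ⟨x, hx, z, hz⟩
      obtain ⟨t, ht, hz⟩ := mem_wordMap_cons.1 hz
      let E := imageIdeal f.1 (T.mono f.1 f.2) C ⟨x, hx, Part.dom_iff_mem.2 ⟨t, ht⟩⟩
      have hE : E ∈ (extend T f).1 C := mem_idealMap.2 fun y => Iff.rfl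
      obtain ⟨D, hD⟩ := ih E ⟨t, ⟨x, hx, t, ht, le_rfl⟩, z, hz⟩
      exact ⟨D, mem_wordMap_cons.2 ⟨E, hE, hD⟩⟩
  obtain ⟨y, hy⟩ := D.nonempty
  obtain ⟨x, hx, z, hz, -⟩ := (h y).1 hy
  obtain ⟨D', hD'⟩ := hdom w C ⟨x, hx, z, hz⟩
  obtain rfl : D = D' := Order.Ideal.ext (Set.ext fun y => (h y).trans (hdown hD' y).symm)
  exact hD'

theorem eta_mem_word_completion {w : List T.F} {x z : X} (hz : z ∈ T.word w x) :
    eta z ∈ T.completion.word (w.map (extend T)) (eta x) := by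
  refine (mem_word_completion T).2 fun y => ⟨fun hy => ⟨x, le_rfl, z, hz, hy⟩, ?_⟩
  rintro ⟨x', hx', z', hz', hyz'⟩
  exact hyz'.trans ((T.partialMonotone_word w).2 _ _ _ _ hx' hz' hz)

/-- The ideals of the closed cover in the completion are the ideals included in the cover. -/
theorem mem_scottClosure_cover_completion {x : X} {C : Order.Ideal X} :
    C ∈ scottClosure (T.completion.cover (eta x)) ↔ ∀ y ∈ C, y ∈ T.cover x := by
  rw [mem_scottClosure_ideal]
  refine forall₂_congr fun y _ => ⟨?_, fun hy => ?_⟩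
  · rintro ⟨B, hB, hyB⟩
    obtain ⟨w, D, hD, hBD⟩ := T.completion.mem_cover.1 hB
    obtain ⟨w, rfl⟩ := List.map_surjective_iff.2 (extend_surjective T) w
    obtain ⟨x', hx', z, hz, hyz⟩ := ((mem_word_completion T).1 hD y).1 (hBD hyB)
    obtain ⟨z', hz', hzz'⟩ := (T.partialMonotone_word w).exists_le hx' hz
    exact T.mem_cover.2 ⟨w, z', hz', hyz.trans hzz'⟩
  · obtain ⟨w, z, hz, hyz⟩ := T.mem_cover.1 hy
    exact ⟨eta z, T.completion.mem_cover.2 ⟨_, _, eta_mem_word_completion T hz, le_rfl⟩, hyz⟩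

/-- Bounded languages exhaust the cover of a state iff they exhaust the closed cover of its image in
the completion. -/
theorem coverBounded_iff_cloverBounded_completion {x : X} :
    T.CoverBounded x ↔ T.completion.CloverBounded (eta x) := by
  constructor
  · rintro ⟨ws, hws⟩
    refine ⟨ws.map (List.map (extend T)), fun C hC => mem_scottClosure_ideal.2 fun y hy => ?_⟩
    obtain ⟨z, ⟨w, hw, hz⟩, hyz⟩ :=
      hws ((mem_scottClosure_cover_completion T).1 (subset_scottClosure _ hC) y hy)
    exact ⟨eta z, ⟨_, mem_boundedLanguage_map List.map_nil (fun _ _ => List.map_append) hw,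
      eta_mem_word_completion T hz⟩, hyz⟩
  · rintro ⟨ws, hws⟩
    obtain ⟨σ, hσ⟩ := (extend_surjective T).hasRightInverse
    refine ⟨ws.map (List.map σ), fun y hy => ?_⟩
    have hmem : eta y ∈ scottClosure (T.completion.runs (boundedLanguage ws) (eta x)) := by
      refine scottClosure_subset_iff.2 hws
        ((mem_scottClosure_cover_completion T).2 fun y' hy' => ?_)
      exact T.isLowerSet_cover x hy' hy
    obtain ⟨D, ⟨w, hw, hD⟩, hyD⟩ := mem_scottClosure_ideal.1 hmem y le_rfl
    have hw' : w = (w.map σ).map (extend T) := by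
      rw [List.map_map, (funext hσ : extend T ∘ σ = id), List.map_id]
    rw [hw', mem_word_completion T] at hD
    obtain ⟨x', hx', z, hz, hyz⟩ := (hD y).1 hyD
    obtain ⟨z', hz', hzz'⟩ := (T.partialMonotone_word _).exists_le hx' hz
    exact ⟨z', ⟨_, mem_boundedLanguage_map List.map_nil (fun _ _ => List.map_append) hw, hz'⟩,
      hyz.trans hzz'⟩

/-- Every ideal included in the cover is below a maximal one. -/
theorem exists_le_mem_clover_completion {x : X} {C : Order.Ideal X}
    (hC : C ∈ scottClosure (T.completion.cover (eta x))) :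
    ∃ M ∈ T.completion.clover (eta x), C ≤ M := by
  obtain ⟨M, hCM, hM⟩ := zorn_le_nonempty₀ (scottClosure (T.completion.cover (eta x)))
    (fun c hc hchain B hB => ⟨_, dirSupClosed_scottClosure _ hc ⟨B, hB⟩ hchain.directedOn
      (isLUB_directedUnion ⟨B, hB⟩ hchain.directedOn),
      fun _ hA => (isLUB_directedUnion ⟨B, hB⟩ hchain.directedOn).1 hA⟩) C hC
  exact ⟨M, by rw [clover_eq_maxSet_scottClosure]; exact hM, hCM⟩

theorem finite_clover_completion (hX : IsOmegaSqWpo X) (x : X) :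
    (T.completion.clover (eta x)).Finite := by
  have := wellQuasiOrderedLE_ideal hX
  refine WellQuasiOrderedLE.finite_of_isAntichain fun A hA B hB hne hle => hne ?_
  exact le_antisymm hle (hA.2 hB.1 hle)

theorem cover_eq_preimage_down_clover (x : X) :
    T.cover x = eta ⁻¹' down (T.completion.clover (eta x)) := by
  ext y
  constructor
  · intro hy
    exact exists_le_mem_clover_completion T
      ((mem_scottClosure_cover_completion T).2 fun y' hy' => T.isLowerSet_cover x hy' hy)
  · rintro ⟨M, hM, hyM⟩
    rw [clover_eq_maxSet_scottClosure] at hM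
    exact (mem_scottClosure_cover_completion T).1 hM.1 y (eta_le_iff.1 hyM)

end Completion

/-! ### Lub-accelerations -/

section Acceleration

variable {S : Type u} [PartialOrder S] {g : S →. S}

/-- If `a ≤ g a`, then all iterates of `g` at `a` are defined, and they form a chain. -/
theorem exists_monotone_iter (hg : PartialMonotone g) {a y : S} (hy : y ∈ g a) (hay : a ≤ y) :
    ∃ v : ℕ → S, Monotone v ∧ ∀ n, v n ∈ iter g n a := by
  have hex : ∀ n, ∃ z, z ∈ iter g n a := by
    intro n
    induction n with
    | zero => exact ⟨a, mem_iter_zero.2 rfl⟩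
    | succ n ih =>
      obtain ⟨z, hz⟩ := ih
      obtain ⟨z', hz', -⟩ := (hg.iter n).exists_le hay hz
      exact ⟨z', mem_iter_succ.2 ⟨y, hy, hz'⟩⟩
  choose v hv using hex
  refine ⟨v, monotone_nat_of_le_succ fun n => ?_, hv⟩
  obtain ⟨t, ht, hz⟩ := mem_iter_succ.1 (hv (n + 1))
  obtain rfl := Part.mem_unique hy ht
  exact (hg.iter n).2 _ _ _ _ hay (hv n) hz

/-- In a dcpo, the value of the lub-acceleration is a genuine least upper bound. -/
theorem mem_accel (hS : IsDcpo S) (hg : PartialMonotone g) {a b : S} (hb : b ∈ accel g a) :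
    ∃ y ∈ g a, (a < y ∧ IsLUB {z | ∃ n, z ∈ iter g n a} b) ∨ (¬ a < y ∧ b = y) := by
  rw [accel, Part.mem_map_iff] at hb
  obtain ⟨y, hy, rfl⟩ := hb
  refine ⟨y, hy, ?_⟩
  split_ifs with hlt
  · left
    refine ⟨hlt, ?_⟩
    obtain ⟨v, hv, hmem⟩ := exists_monotone_iter hg hy hlt.le
    have hex : ∃ b, IsLUB {z | ∃ n, z ∈ iter g n a} b := by
      rw [setOf_iter_eq_range hmem]
      exact hS _ (Set.range_nonempty v) (directedOn_range.2 hv.directed_le)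
    rw [lubOr, dif_pos hex]
    exact hex.choose_spec
  · exact Or.inr ⟨hlt, rfl⟩

theorem le_accel (hS : IsDcpo S) (hg : PartialMonotone g) {a b z : S} (hb : b ∈ accel g a)
    (hz : z ∈ g a) : z ≤ b := by
  obtain ⟨y, hy, ⟨-, hlub⟩ | ⟨-, rfl⟩⟩ := mem_accel hS hg hb
  · exact hlub.1 ⟨1, mem_iter_succ.2 ⟨z, hz, mem_iter_zero.2 rfl⟩⟩
  · exact (Part.mem_unique hz hy).le

/-- If `a ≤ g a`, then the accelerated value `b` satisfies `a ≤ b` and `g b ≤ b` (where defined).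
The continuity of `g` is used through the preimages of closed sets. -/
theorem accel_of_le (hS : IsDcpo S) (hg : PartialMonotone g)
    (hcont : ∀ B : Set S, DirSupClosed B → DirSupClosed {x | ∀ z ∈ g x, z ∈ B})
    {a b y : S} (hy : y ∈ g a) (hay : a ≤ y) (hb : b ∈ accel g a) :
    a ≤ b ∧ ∀ z ∈ g b, z ≤ b := by
  obtain ⟨y', hy', ⟨-, hlub⟩ | ⟨hlt, rfl⟩⟩ := mem_accel hS hg hb
  · refine ⟨hlub.1 ⟨0, mem_iter_zero.2 rfl⟩, ?_⟩
    obtain ⟨v, hv, hmem⟩ := exists_monotone_iter hg hy hay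
    rw [setOf_iter_eq_range hmem] at hlub
    refine hcont (Set.Iic b) (dirSupClosed_Iic b) ?_ (Set.range_nonempty v)
      (directedOn_range.2 hv.directed_le) hlub
    rintro _ ⟨n, rfl⟩ z hz
    exact hlub.1 ⟨n + 1, Part.mem_unique (hmem (n + 1)) (mem_iter_succ'.2 ⟨_, hmem n, hz⟩)⟩
  · obtain rfl := Part.mem_unique hy hy'
    obtain rfl : a = y := hay.eq_of_not_lt hlt
    exact ⟨le_rfl, fun z hz => (Part.mem_unique hz hy).le⟩

end Acceleration

/-! ### Correctness of the procedure -/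

section Procedure

variable {S : Type u} [PartialOrder S] {T : OrdFunTS S}

theorem OrdFunTS.IsComplete.dirSupClosed_preimage_word (hT : T.IsComplete) (w : List T.F)
    {B : Set S} (hs : DirSupClosed B) :
    DirSupClosed {x | ∀ z ∈ T.word w x, z ∈ B} := by
  induction w with
  | nil => simpa only [OrdFunTS.word, List.map_nil, mem_wordMap_nil, forall_eq,
      Set.ofPred_mem_eq] using hs
  | cons f w ih =>
    have heq : {x | ∀ z ∈ T.word (f :: w) x, z ∈ B} =
        {x | ∀ t ∈ f.1 x, t ∈ {x | ∀ z ∈ T.word w x, z ∈ B}} := by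
      ext x
      constructor
      · exact fun h t ht z hz => h z (mem_wordMap_cons.2 ⟨t, ht, hz⟩)
      · intro h z hz
        obtain ⟨t, ht, hz⟩ := mem_wordMap_cons.1 hz
        exact h t ht z hz
    rw [heq]
    exact (hT.2 _ f.2).dirSupClosed_preimage (T.mono _ f.2) ih

/-- Words map the Scott closure of a set into the Scott closure of its image. -/
theorem OrdFunTS.IsComplete.word_mem_scottClosure (hT : T.IsComplete) (w : List T.F) {E B : Set S}
    (h : ∀ e ∈ E, ∀ z ∈ T.word w e, z ∈ scottClosure B) {a z : S} (ha : a ∈ scottClosure E)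
    (hz : z ∈ T.word w a) : z ∈ scottClosure B :=
  scottClosure_minimal (B := {x | ∀ z ∈ T.word w x, z ∈ scottClosure B}) h
    ((T.partialMonotone_word w).isLowerSet_preimage (isLowerSet_scottClosure B))
    (hT.dirSupClosed_preimage_word w (dirSupClosed_scottClosure B))
    ha z hz

theorem OrdFunTS.iter_word (w : List T.F) (n : ℕ) :
    iter (T.word w) n = T.word (List.replicate n w).flatten := by
  rw [OrdFunTS.word, OrdFunTS.word, iter_wordMap, List.map_flatten, List.map_replicate]

/-- The accelerated value along `w` of a point in the closure of the runs along `ws` lies in the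
closure of the runs along `ws` followed by iterations of `w`. -/
theorem accel_mem_scottClosure_runs (hT : T.IsComplete) {s a b : S} {ws : List (List T.F)}
    (ha : a ∈ scottClosure (T.runs (boundedLanguage ws) s)) {w : List T.F}
    (hb : b ∈ accel (T.word w) a) :
    b ∈ scottClosure (T.runs (boundedLanguage (ws ++ [w])) s) := by
  have hiter : ∀ n, ∀ z ∈ iter (T.word w) n a,
      z ∈ scottClosure (T.runs (boundedLanguage (ws ++ [w])) s) := by
    intro n z hz
    rw [OrdFunTS.iter_word] at hz
    refine hT.word_mem_scottClosure _ ?_ ha hz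
    rintro e ⟨x, hx, he⟩ z hz
    refine subset_scottClosure _ ⟨x ++ (List.replicate n w).flatten, ?_, ?_⟩
    · exact append_mem_boundedLanguage hx (mem_boundedLanguage_cons.2
        ⟨n, [], nil_mem_boundedLanguage [], (List.append_nil _).symm⟩)
    · rw [OrdFunTS.word, List.map_append, mem_wordMap_append]
      exact ⟨e, he, hz⟩
  obtain ⟨y, hy, ⟨hlt, hlub⟩ | ⟨-, rfl⟩⟩ := mem_accel hT.1.1 (T.partialMonotone_word w) hb
  · obtain ⟨v, hv, hmem⟩ := exists_monotone_iter (T.partialMonotone_word w) hy hlt.le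
    rw [setOf_iter_eq_range hmem] at hlub
    refine dirSupClosed_scottClosure _ ?_ (Set.range_nonempty v)
      (directedOn_range.2 hv.directed_le) hlub
    rintro _ ⟨n, rfl⟩
    exact hiter n _ (hmem n)
  · exact hiter 1 _ (mem_iter_succ.2 ⟨_, hy, mem_iter_zero.2 rfl⟩)

/-- Along any execution the current set is finite, contains the initial state, and consists of
points in the closure of the runs along bounded languages. -/
theorem execution_invariant (hT : T.IsComplete) {s₀ : S} {A : ℕ → Set S} {c : ℕ → (S →. S) × S}
    (h0 : A 0 = {s₀}) {n : ℕ} (hA : ∀ m < n, CloverTurn T (A m) (c m) (A (m + 1))) :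
    (A n).Finite ∧ s₀ ∈ A n ∧
      ∀ a ∈ A n, ∃ ws, a ∈ scottClosure (T.runs (boundedLanguage ws) s₀) := by
  induction n with
  | zero =>
    rw [h0]
    refine ⟨Set.finite_singleton _, rfl, ?_⟩
    rintro _ rfl
    exact ⟨[], subset_scottClosure _ ⟨[], nil_mem_boundedLanguage _, mem_wordMap_nil.2 rfl⟩⟩
  | succ n ih =>
    obtain ⟨hfin, hs, hcl⟩ := ih fun m hm => hA m (by omega)
    obtain ⟨-, hg, ha, b, hb, heq⟩ := hA n (by omega)
    rw [heq]
    refine ⟨hfin.union (Set.finite_singleton b), Or.inl hs, ?_⟩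
    rintro x (hx | rfl)
    · exact hcl x hx
    · obtain ⟨ws, hws⟩ := hcl _ ha
      obtain ⟨w, hw⟩ := T.mem_compositions_iff.1 hg
      rw [hw] at hb
      exact ⟨_, accel_mem_scottClosure_runs hT hws hb⟩

/-- A finite set of points in closures of runs along bounded languages lies in the closure of the
runs along a single bounded language. -/
theorem exists_boundedLanguage_of_finite {s₀ : S} {A : Set S} (hA : A.Finite)
    (h : ∀ a ∈ A, ∃ ws, a ∈ scottClosure (T.runs (boundedLanguage ws) s₀)) :
    ∃ ws, A ⊆ scottClosure (T.runs (boundedLanguage ws) s₀) := by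
  induction A, hA using Set.Finite.induction_on with
  | empty => exact ⟨[], Set.empty_subset _⟩
  | @insert a A _ _ ih =>
    obtain ⟨ws, hws⟩ := ih fun b hb => h b (Set.mem_insert_of_mem a hb)
    obtain ⟨ws', hws'⟩ := h a (Set.mem_insert a A)
    refine ⟨ws' ++ ws, Set.insert_subset (scottClosure_mono ?_ hws')
      (hws.trans (scottClosure_mono ?_))⟩
    · rintro z ⟨w, hw, hz⟩
      exact ⟨w, mem_boundedLanguage_append_left _ hw, hz⟩
    · rintro z ⟨w, hw, hz⟩
      exact ⟨w, mem_boundedLanguage_append_right _ hw, hz⟩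

/-- When an execution halts, the downward closure of its current set is the closed cover, and the
latter is exhausted by a bounded language. -/
theorem CloverReturns.spec (hT : T.IsComplete) {s₀ : S} {R : Set S} (h : CloverReturns T s₀ R) :
    T.CloverBounded s₀ ∧ R = maxSet (scottClosure (T.cover s₀)) := by
  obtain ⟨N, A, c, h0, hA, hhalt, rfl⟩ := h
  obtain ⟨hfin, hs, hcl⟩ := execution_invariant hT h0 hA
  obtain ⟨ws, hws⟩ := exists_boundedLanguage_of_finite hfin hcl
  have hcover : T.cover s₀ ⊆ down (A N) := by
    refine T.cover_subset_of_post_subset (isLowerSet_down _) ?_ (subset_down _ hs)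
    rintro z ⟨x, ⟨a, ha, hxa⟩, f, hf, hz⟩
    obtain ⟨z', hz', hle⟩ := (T.mono f hf).exists_le hxa hz
    obtain ⟨b, hb, hle'⟩ := hhalt z' ⟨a, ha, f, hf, hz'⟩
    exact ⟨b, hb, hle.trans hle'⟩
  have hdown := (down_subset_iff (isLowerSet_scottClosure _)).2 hws
  refine ⟨⟨ws, hcover.trans hdown⟩, ?_⟩
  rw [← maxSet_down (A N)]
  congr 1
  refine Set.Subset.antisymm (hdown.trans (scottClosure_mono (T.runs_subset_cover _ _))) ?_
  exact scottClosure_minimal hcover (isLowerSet_down _) (dirSupClosed_down_of_finite hfin)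

/-! ### Existence of halting executions -/

/-- If no execution halts, there is an infinite fair one: let the choices be governed by an
enumeration in which every position in the list of states found so far and every word recur
arbitrarily late. -/
theorem CloverTerminates.exists_returns {s₀ : S} (h : CloverTerminates T s₀) :
    ∃ R, CloverReturns T s₀ R := by
  classical
  by_contra! hno
  refine h ?_
  have := T.finite.to_subtype
  obtain ⟨e, he⟩ := exists_surjective_nat (List T.F)
  -- the pair requested at turn `n`, replaced by `(id, s₀)` if it is not available
  let choice : ℕ → List S → List T.F × S := fun n l =>
    match l[n.unpair.2.unpair.1]? with
    | some a =>
      if (T.word (e n.unpair.2.unpair.2) a).Dom then (e n.unpair.2.unpair.2, a) else ([], s₀)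
    | none => ([], s₀)
  have hdom : ∀ n l, (accel (T.word (choice n l).1) (choice n l).2).Dom := by
    intro n l
    simp only [choice]
    split
    · split_ifs with hd
      · exact hd
      · trivial
    · trivial
  have hmem : ∀ n l, s₀ ∈ l → (choice n l).2 ∈ l := by
    intro n l hl
    simp only [choice]
    split
    · next a ha =>
      split_ifs
      · exact List.mem_of_getElem? ha
      · exact hl
    · exact hl
  let next : ℕ → List S → List S := fun n l =>
    l ++ [(accel (T.word (choice n l).1) (choice n l).2).get (hdom n l)]
  let L : ℕ → List S := fun n => Nat.rec [s₀] next n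
  have hL : ∀ n, L (n + 1) = next n (L n) := fun n => rfl
  have hs : ∀ n, s₀ ∈ L n := by
    intro n
    induction n with
    | zero => exact List.mem_singleton.2 rfl
    | succ n ih => rw [hL]; exact List.mem_append_left _ ih
  have hprefix : ∀ m n, m ≤ n → L m <+: L n := by
    intro m n hmn
    induction n, hmn using Nat.le_induction with
    | base => exact List.prefix_rfl
    | succ n _ ih => exact ih.trans (List.prefix_append _ _)
  let A : ℕ → Set S := fun n => {x | x ∈ L n}
  let c : ℕ → (S →. S) × S := fun n => (T.word (choice n (L n)).1, (choice n (L n)).2)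
  have h0 : A 0 = {s₀} := Set.ext fun x => List.mem_singleton
  have hturn : ∀ n, CloverTurn T (A n) (c n) (A (n + 1)) := by
    intro n
    induction n using Nat.strong_induction_on with
    | _ n ih =>
      refine ⟨fun hhalt => hno _ ⟨n, A, c, h0, ih, hhalt, rfl⟩, T.mem_compositions_iff.2 ⟨_, rfl⟩,
        hmem n _ (hs n), _, Part.get_mem (hdom n (L n)), ?_⟩
      ext x
      simp only [A, hL, next, Set.mem_ofPred_eq, List.mem_append, List.mem_singleton, Set.mem_union,
        Set.mem_singleton_iff]
  refine ⟨A, c, ⟨h0, hturn⟩, fun m g hg a ha hag => ?_⟩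
  obtain ⟨w, rfl⟩ := T.mem_compositions_iff.1 hg
  obtain ⟨j, rfl⟩ := he w
  obtain ⟨i, hi⟩ := List.mem_iff_getElem?.1 (show a ∈ L m from ha)
  have hle : m ≤ Nat.pair m (Nat.pair i j) := Nat.left_le_pair _ _
  refine ⟨Nat.pair m (Nat.pair i j), hle, ?_⟩
  have hi' : (L (Nat.pair m (Nat.pair i j)))[i]? = some a := by
    obtain ⟨t, ht⟩ := hprefix _ _ hle
    rw [← ht, List.getElem?_append_left (List.getElem?_eq_some_iff.1 hi).1, hi]
  have hch : choice (Nat.pair m (Nat.pair i j)) (L (Nat.pair m (Nat.pair i j))) = (e j, a) := by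
    simp only [choice, Nat.unpair_pair, hi']
    exact if_pos hag
  simp only [c, hch]

/-! ### Termination from bounded languages -/

/-- Let `U` be a set of states closed under the accelerations of all words. In a well order,
finitely many points of `U` dominate all iterates of a given word at a given point of `U`. -/
theorem exists_finite_dominating_iter (hT : T.IsComplete) {U : Set S}
    (hU : ∀ w : List T.F, ∀ a ∈ U, (T.word w a).Dom → ∃ b ∈ accel (T.word w) a, b ∈ U)
    (w : List T.F) {e : S} (he : e ∈ U) :
    ∃ E ⊆ U, E.Finite ∧ ∀ n, ∀ z ∈ iter (T.word w) n e, z ∈ down E := by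
  classical
  have hmono := T.partialMonotone_word w
  have hdcpo := hT.1.1
  -- accelerate where possible, and otherwise stay
  have hex : ∀ a ∈ U, ∃ b ∈ U, ((T.word w a).Dom → b ∈ accel (T.word w) a) := by
    intro a ha
    by_cases hd : (T.word w a).Dom
    · obtain ⟨b, hb, hbU⟩ := hU w a ha hd
      exact ⟨b, hbU, fun _ => hb⟩
    · exact ⟨a, ha, fun h => (hd h).elim⟩
  choose! next hnextU hnext using hex
  have hseqU : ∀ a ∈ U, ∀ n, next^[n] a ∈ U := by
    intro a ha n
    induction n with
    | zero => exact ha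
    | succ n ih => rw [Function.iterate_succ_apply']; exact hnextU _ ih
  have hdomin : ∀ a ∈ U, ∀ n, ∀ z ∈ iter (T.word w) n a, z ≤ next^[n] a := by
    intro a ha n
    induction n with
    | zero => exact fun z hz => (mem_iter_zero.1 hz).le
    | succ n ih =>
      intro z hz
      obtain ⟨t, ht, hz⟩ := mem_iter_succ'.1 hz
      obtain ⟨y, hy, hzy⟩ := hmono.exists_le (ih t ht) hz
      rw [Function.iterate_succ_apply']
      exact hzy.trans (le_accel hdcpo hmono
        (hnext _ (hseqU a ha n) (Part.dom_iff_mem.2 ⟨y, hy⟩)) hy)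
  have hfin : ∀ n, ((fun m => next^[m] e) '' Set.Iic n).Finite := fun n =>
    (Set.finite_Iic n).image _
  have hsub : ∀ n, (fun m => next^[m] e) '' Set.Iic n ⊆ U := by
    rintro n _ ⟨m, _, rfl⟩
    exact hseqU e he m
  -- if the word does not map some point of the sequence outside its lower cone, the sequence may
  -- end there
  by_cases hpre : ∃ n, ∀ z ∈ T.word w (next^[n] e), z ≤ next^[n] e
  · obtain ⟨n, hn⟩ := hpre
    refine ⟨_, hsub n, hfin n, fun m z hz => ?_⟩
    rcases le_total m n with hmn | hnm
    · exact ⟨_, ⟨m, hmn, rfl⟩, hdomin e he m z hz⟩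
    · refine ⟨_, ⟨n, Set.mem_Iic.2 le_rfl, rfl⟩, ?_⟩
      induction m, hnm using Nat.le_induction generalizing z with
      | base => exact hdomin e he n z hz
      | succ m _ ih =>
        obtain ⟨t, ht, hz⟩ := mem_iter_succ'.1 hz
        obtain ⟨y, hy, hzy⟩ := hmono.exists_le (ih t ht) hz
        exact hzy.trans (hn y hy)
  push Not at hpre
  have hdom : ∀ n, (T.word w (next^[n] e)).Dom := fun n => by
    obtain ⟨z, hz, -⟩ := hpre n
    exact Part.dom_iff_mem.2 ⟨z, hz⟩
  -- a strict increase would be accelerated to a point `b` with `g b ≤ b`, against `hpre`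
  have hstep : ∀ n, next^[n + 1] e ∈ T.word w (next^[n] e) := by
    intro n
    have hacc := hnext _ (hseqU e he n) (hdom n)
    obtain ⟨y, hy, ⟨hlt, -⟩ | ⟨-, heq⟩⟩ := mem_accel hdcpo hmono hacc
    · obtain ⟨z, hz, hnle⟩ := hpre (n + 1)
      rw [Function.iterate_succ_apply'] at hz hnle
      exact (hnle ((accel_of_le hdcpo hmono
        (fun _ hs => hT.dirSupClosed_preimage_word w hs) hy hlt.le hacc).2 z hz)).elim
    · rw [Function.iterate_succ_apply', heq]
      exact hy
  have hstep' : ∀ k n, next^[n + k] e ∈ iter (T.word w) k (next^[n] e) := by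
    intro k
    induction k with
    | zero => exact fun n => mem_iter_zero.2 rfl
    | succ k ih => exact fun n => mem_iter_succ'.2 ⟨_, ih n, hstep (n + k)⟩
  -- so the sequence consists of iterates, and the well order provides a period `k` up to domination
  obtain ⟨i, j, hij, hle⟩ := hT.1.2.2.wqo fun n => next^[n] e
  obtain ⟨k, rfl⟩ := Nat.exists_eq_add_of_lt hij
  have hk := hstep' (k + 1) i
  obtain ⟨w', hw'⟩ : ∃ w', iter (T.word w) (k + 1) = T.word w' := ⟨_, OrdFunTS.iter_word w (k + 1)⟩
  rw [hw'] at hk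
  obtain ⟨p, hp, hpU⟩ := hU w' _ (hseqU e he i) (Part.dom_iff_mem.2 ⟨_, hk⟩)
  obtain ⟨hip, hpp⟩ := accel_of_le hdcpo (T.partialMonotone_word w')
    (fun _ hs => hT.dirSupClosed_preimage_word w' hs) hk hle hp
  -- from index `i` on, the iterates are dominated by the first `k + 1` iterates at `p`
  have hcycle : ∀ m, i ≤ m → ∃ r ≤ k, ∃ t ∈ iter (T.word w) r p, next^[m] e ≤ t := by
    intro m hm
    induction m, hm using Nat.le_induction with
    | base => exact ⟨0, Nat.zero_le k, p, mem_iter_zero.2 rfl, hip⟩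
    | succ m _ ih =>
      obtain ⟨r, hr, t, ht, hle⟩ := ih
      obtain ⟨y, hy, hley⟩ := hmono.exists_le hle (hstep m)
      rcases hr.eq_or_lt with rfl | hlt
      · refine ⟨0, Nat.zero_le _, p, mem_iter_zero.2 rfl, hley.trans (hpp y ?_)⟩
        rw [← hw']
        exact mem_iter_succ'.2 ⟨t, ht, hy⟩
      · exact ⟨r + 1, hlt, y, mem_iter_succ'.2 ⟨t, ht, hy⟩, hley⟩
  refine ⟨_ ∪ (fun r => next^[r] p) '' Set.Iic k, Set.union_subset (hsub i) ?_,
    (hfin i).union ((Set.finite_Iic k).image _), fun m z hz => ?_⟩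
  · rintro _ ⟨r, _, rfl⟩
    exact hseqU p hpU r
  · rcases le_total m i with hmi | him
    · exact ⟨_, Or.inl ⟨m, hmi, rfl⟩, hdomin e he m z hz⟩
    · obtain ⟨r, hr, t, ht, hle⟩ := hcycle m him
      exact ⟨_, Or.inr ⟨r, hr, rfl⟩,
        (hdomin e he m z hz).trans (hle.trans (hdomin p hpU r t ht))⟩

/-- Under the same closure assumption, finitely many points of `U` dominate all runs along a bounded
language. -/
theorem exists_finite_dominating_runs (hT : T.IsComplete) {U : Set S}
    (hU : ∀ w : List T.F, ∀ a ∈ U, (T.word w a).Dom → ∃ b ∈ accel (T.word w) a, b ∈ U)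
    (ws : List (List T.F)) {e : S} (he : e ∈ U) :
    ∃ E ⊆ U, E.Finite ∧ T.runs (boundedLanguage ws) e ⊆ down E := by
  induction ws generalizing e with
  | nil =>
    refine ⟨{e}, Set.singleton_subset_iff.2 he, Set.finite_singleton e, ?_⟩
    rintro z ⟨w, hw, hz⟩
    rw [mem_boundedLanguage_nil.1 hw] at hz
    exact ⟨e, rfl, (mem_wordMap_nil.1 hz).le⟩
  | cons v ws ih =>
    obtain ⟨E, hEU, hE, hdom⟩ := exists_finite_dominating_iter hT hU v he
    choose! F hFU hF hFdom using fun a (ha : a ∈ U) => ih ha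
    refine ⟨⋃ a ∈ E, F a, Set.iUnion₂_subset fun a ha => hFU a (hEU ha),
      hE.biUnion fun a ha => hF a (hEU ha), ?_⟩
    rintro z ⟨w, hw, hz⟩
    obtain ⟨n, x, hx, rfl⟩ := mem_boundedLanguage_cons.1 hw
    rw [OrdFunTS.word, List.map_append, mem_wordMap_append] at hz
    obtain ⟨t, ht, hz⟩ := hz
    obtain ⟨a, ha, hta⟩ := hdom n t (by rw [OrdFunTS.iter_word]; exact ht)
    obtain ⟨z', hz', hle⟩ := (T.partialMonotone_word x).exists_le hta hz
    obtain ⟨b, hb, hle'⟩ := hFdom a (hEU ha) ⟨x, hx, hz'⟩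
    exact ⟨b, Set.mem_iUnion₂.2 ⟨a, ha, hb⟩, hle.trans hle'⟩

/-- If a bounded language exhausts the closed cover, then every infinite fair execution would
eventually dominate the cover, and hence halt. -/
theorem OrdFunTS.CloverBounded.terminates (hT : T.IsComplete) {s₀ : S} (h : T.CloverBounded s₀) :
    CloverTerminates T s₀ := by
  rintro ⟨A, c, ⟨h0, hturn⟩, hfair⟩
  obtain ⟨ws, hws⟩ := h
  have hmono : Monotone A := monotone_nat_of_le_succ fun n => by
    obtain ⟨-, -, -, b, -, heq⟩ := hturn n
    rw [heq]
    exact Set.subset_union_left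
  have hU : ∀ w : List T.F, ∀ a ∈ ⋃ n, A n, (T.word w a).Dom →
      ∃ b ∈ accel (T.word w) a, b ∈ ⋃ n, A n := by
    intro w a ha hd
    obtain ⟨m, hm⟩ := Set.mem_iUnion.1 ha
    obtain ⟨n, -, hn⟩ := hfair m _ (T.mem_compositions_iff.2 ⟨w, rfl⟩) a hm hd
    obtain ⟨-, -, -, b, hb, heq⟩ := hturn n
    rw [hn] at hb
    exact ⟨b, hb, Set.mem_iUnion.2 ⟨n + 1, by rw [heq]; exact Or.inr rfl⟩⟩
  obtain ⟨E, hEU, hE, hdom⟩ := exists_finite_dominating_runs hT hU ws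
    (Set.mem_iUnion.2 ⟨0, by rw [h0]; rfl⟩)
  obtain ⟨n, hn⟩ : ∃ n, E ⊆ A n := by
    lift E to Finset S using hE
    exact hmono.directed_le.exists_mem_subset_of_finset_subset_biUnion hEU
  have hclosed : scottClosure (T.cover s₀) ⊆ down (A n) := by
    refine scottClosure_subset_iff.2 hws |>.trans ?_
    refine (scottClosure_minimal hdom (isLowerSet_down _) (dirSupClosed_down_of_finite hE)).trans ?_
    rintro x ⟨b, hb, hxb⟩
    exact ⟨b, hn hb, hxb⟩
  obtain ⟨-, -, hcl⟩ := execution_invariant hT h0 (n := n) fun m _ => hturn m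
  refine (hturn n).1 ?_
  rintro z ⟨a, ha, f, hf, hz⟩
  obtain ⟨ws', hws'⟩ := hcl a ha
  refine hclosed (hT.word_mem_scottClosure [⟨f, hf⟩] ?_ hws'
    (mem_wordMap_cons.2 ⟨z, hz, mem_wordMap_nil.2 rfl⟩))
  rintro y ⟨w, -, hy⟩ z hz
  refine subset_scottClosure _ (T.mem_cover.2 ⟨w ++ [⟨f, hf⟩], z, ?_, le_rfl⟩)
  rw [OrdFunTS.word, List.map_append, mem_wordMap_append]
  exact ⟨y, hy, hz⟩

end Procedure

end CoverFlat

theorem mainTheorem2 {X : Type u} [PartialOrder X] (T : OrdFunTS X) (x₀ : X)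
    (hX : IsOmegaSqWpo X) (heff : InftyEffective T.completion) :
    List.TFAE
      [ CoverFlattable T x₀,
        WeaklyCoverFlattable T x₀,
        StronglyCoverFlattable T x₀,
        CloverFlattable T.completion (eta x₀),
        WeaklyCloverFlattable T.completion (eta x₀),
        StronglyCloverFlattable T.completion (eta x₀),
        CloverTerminates T.completion (eta x₀) ] ∧
    (CloverTerminates T.completion (eta x₀) →
      (∀ R, CloverReturns T.completion (eta x₀) R ↔ R = T.completion.clover (eta x₀)) ∧
      (T.completion.clover (eta x₀)).Finite ∧
      T.cover x₀ = eta ⁻¹' down (T.completion.clover (eta x₀))) := by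
  have hT := isComplete_completion T hX
  have hret : ∀ R, CloverReturns T.completion (eta x₀) R → R = T.completion.clover (eta x₀) :=
    fun R hR => (hR.spec hT).2.trans clover_eq_maxSet_scottClosure.symm
  refine ⟨?_, fun h => ⟨fun R => ⟨hret R, ?_⟩, finite_clover_completion T hX x₀,
    cover_eq_preimage_down_clover T x₀⟩⟩
  · tfae_have 1 → 2 := CoverFlattable.weakly
    tfae_have 2 → 3 := fun h => h.coverBounded.strongly
    tfae_have 3 → 1 := StronglyCoverFlattable.coverFlattable
    tfae_have 4 → 5 := CloverFlattable.weakly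
    tfae_have 5 → 6 := fun h => h.cloverBounded.strongly
    tfae_have 6 → 4 := StronglyCloverFlattable.cloverFlattable hT
    tfae_have 2 → 7 := fun h =>
      ((coverBounded_iff_cloverBounded_completion T).1 h.coverBounded).terminates hT
    tfae_have 7 → 6 := fun h => by
      obtain ⟨R, hR⟩ := h.exists_returns
      exact (hR.spec hT).1.strongly
    tfae_have 5 → 3 := fun h =>
      ((coverBounded_iff_cloverBounded_completion T).2 h.cloverBounded).strongly
    tfae_finish
  · rintro rfl
    obtain ⟨R, hR⟩ := h.exists_returns
    rwa [← hret R hR]
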